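/- Let $M\ge 1$, let $C=\begin{bmatrix}a&b\\c&d\end{bmatrix}$ be a unitary matrix with $a\neq0$, and write $|L\rangle=[1,0]^{\mathsf T}$, $|R\rangle=[0,1]^{\mathsf T}$. On $\mathcal H=\ell^2(\mathbb Z;\mathbb C^2)$ let $U$ be the quantum walk $(U\psi)(x)=P_{x+1}\psi(x+1)+Q_{x-1}\psi(x-1)$, where $P_x=|L\rangle\langle L|C_x$, $Q_x=|R\rangle\langle R|C_x$, $C_x=C$ for $x\in\Gamma_M=\{0,\dots,M-1\}$ and $C_x=I_2$ otherwise, and let $U_0$ be the free walk (all coins equal to $I_2$). Let $\mathcal U:\mathcal H\to L^2(\mathbb T;\mathbb C^2)$, $(\mathcal U f)(\xi)=(2\pi)^{-1/2}\sum_{x}e^{-ix\xi}f(x)$, $\mathbb T=\mathbb R/2\pi\mathbb Z$, be the unitary Fourier transform. Let $E_M$ be the $2M\times 2M$ matrix with entries $(E_M)_{(x;J),(x';J')}=\langle \delta_x|J\rangle, U\delta_{x'}|J'\rangle\rangle$, $x,x'\in\Gamma_M$, $J,J'\in\{L,R\}$. Then $1-(e^{-i\xi}E_M)^2$ is invertible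 for every $\xi\in\mathbb T$; put $G_M(\xi)=(1-(e^{-i\xi}E_M)^2)^{-1}$ and \begin{align*} \widehat a_M(\xi)&=a\,\bigl(E_M^{M-1}G_M(\xi)\bigr)_{(0;L),(M-1;L)},\\ \widehat b_M(\xi)&=b+a\,\bigl((e^{-i\xi}E_M)^2G_M(\xi)\bigr)_{(0;L),(0;R)},\\ \widehat c_M(\xi)&=\Bigl(c+d\,\bigl((e^{i\xi}E_M)^2G_M(-\xi)\bigr)_{(M-1;R),(M-1;L)}\Bigr)e^{-2i\xi(M-1)},\\ \widehat d_M(\xi)&=d\,\bigl(E_M^{M-1}G_M(-\xi)\bigr)_{(M-1;R),(0;R)}. \end{align*} The wave operators $W_\pm=\operatorname{s-lim}_{t\to\pm\infty}U^{-t}U_0^t$ exist, and with $\Sigma_M=W_+^*W_-$ and $\widehat S=\mathcal U\Sigma_M\mathcal U^{-1}$ the following hold. (1) For every $\psi\in L^2(\mathbb T;\mathbb C^2)$ and almost every $\xi\in\mathbb T$, $$(\widehat S\psi)(\xi)=\begin{bmatrix}\widehat a_M(\xi)&0\\0&\widehat d_M(\xi)\end{bmatrix}\psi(\xi)+\begin{bmatrix}0&\widehat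 b_M(\xi)\\\widehat c_M(\xi)&0\end{bmatrix}\psi(-\xi).$$ (2) For $\theta\in\mathbb R$ let $M(\theta)=\{\xi\in\mathbb T:\det(\operatorname{diag}(e^{i\xi},e^{-i\xi})-e^{i\theta})=0\}=\{\xi_+(\theta),\xi_-(\theta)\}$ with $\xi_+(\theta)=\arccos(\cos\theta)$ and $\xi_-(\theta)=2\pi-\arccos(\cos\theta)$, and let ${\bf h}(\theta)$ be the space of functions $M(\theta)\to\mathbb C^2$. Then there are linear operators $\widehat\Sigma_M(\theta)$ on ${\bf h}(\theta)$ given, for all $\theta\in\mathbb R$, $\psi\in{\bf h}(\theta)$ and $s\in\{+,-\}$, by $$(\widehat\Sigma_M(\theta)\psi)(\xi_s(\theta))=\begin{bmatrix}\widehat a_M(\xi_s(\theta))&0\\0&\widehat d_M(\xi_s(\theta))\end{bmatrix}\psi(\xi_s(\theta))+\begin{bmatrix}0&\widehat b_M(\xi_s(\theta))\\\widehat c_M(\xi_s(\theta))&0\end{bmatrix}\psi(-\xi_s(\theta)),$$ and they form the scattering matrix: for every $f\in L^2(\mathbb T;\mathbb C^2)$ one has $(\widehat Sf)|_{M(\theta)}=\widehat\Sigma_M(\theta)\bigl(f|_{M(\theta)}\bigr)$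 for almost every $\theta\in[0,2\pi]$, and any other family of linear operators on the spaces ${\bf h}(\theta)$ with this property agrees with $\widehat\Sigma_M(\theta)$ for almost every $\theta\in[0,2\pi]$. -/

import Mathlib

open MeasureTheory Filter Topology
open scoped ENNReal

noncomputable section

namespace QuantumWalk

/-! ### The walk on the line

Chiralities are indexed by `Fin 2`: the index `0` is `L`, the index `1` is `R`. -/

/-- The internal space `ℂ²` with its Euclidean norm. -/
abbrev Spinor : Type := EuclideanSpace ℂ (Fin 2)

/-- The Hilbert space `ℓ²(ℤ; ℂ²)`. -/
abbrev StateSpace : Type := lp (fun _ : ℤ => Spinor) 2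

/-- The basis vectors `|L⟩ = [1, 0]ᵀ` (index `0`) and `|R⟩ = [0, 1]ᵀ` (index `1`) of `ℂ²`. -/
def ket (J : Fin 2) : Spinor := EuclideanSpace.single J 1

/-- The state `δ_x |J⟩`. -/
def delta (x : ℤ) (J : Fin 2) : StateSpace := lp.single 2 x (ket J)

/-- `P = |L⟩⟨L| C`. -/
def leftWeight (C : Matrix.unitaryGroup (Fin 2) ℂ) : Matrix (Fin 2) (Fin 2) ℂ :=
  !![1, 0; 0, 0] * (C : Matrix (Fin 2) (Fin 2) ℂ)

/-- `Q = |R⟩⟨R| C`. -/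
def rightWeight (C : Matrix.unitaryGroup (Fin 2) ℂ) : Matrix (Fin 2) (Fin 2) ℂ :=
  !![0, 0; 0, 1] * (C : Matrix (Fin 2) (Fin 2) ℂ)

/-- Matrix-vector multiplication on `ℂ²`. -/
def act (A : Matrix (Fin 2) (Fin 2) ℂ) : Spinor →ₗ[ℂ] Spinor := Matrix.toLpLin 2 2 A

/-- One step of the walk on arbitrary sequences:
`(U f)(x) = P_{x+1} f(x+1) + Q_{x-1} f(x-1)`. -/
def step (C : ℤ → Matrix.unitaryGroup (Fin 2) ℂ) (f : ℤ → Spinor) (x : ℤ) : Spinor :=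
  act (leftWeight (C (x + 1))) (f (x + 1)) + act (rightWeight (C (x - 1))) (f (x - 1))

/-- One step backwards; used only to show that the walk is onto. -/
def stepInv (C : ℤ → Matrix.unitaryGroup (Fin 2) ℂ) (f : ℤ → Spinor) (x : ℤ) : Spinor :=
  act (star (C x : Matrix (Fin 2) (Fin 2) ℂ)) (WithLp.toLp 2 ![f (x - 1) 0, f (x + 1) 1])

theorem act_apply (A : Matrix (Fin 2) (Fin 2) ℂ) (v : Spinor) (i : Fin 2) :
    act A v i = A i 0 * v 0 + A i 1 * v 1 := by
  fin_cases i <;> simp [act, Matrix.toLpLin_apply]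

theorem act_mul (A B : Matrix (Fin 2) (Fin 2) ℂ) (v : Spinor) :
    act (A * B) v = act A (act B v) := by
  simp [act, Matrix.toLpLin_apply]

theorem act_one (v : Spinor) : act 1 v = v := by
  simp [act]

theorem step_zero (C : ℤ → Matrix.unitaryGroup (Fin 2) ℂ) (f : ℤ → Spinor) (x : ℤ) :
    step C f x 0 = act (C (x + 1) : Matrix (Fin 2) (Fin 2) ℂ) (f (x + 1)) 0 := by
  simp only [step, leftWeight, rightWeight, act_mul, PiLp.add_apply]
  rw [act_apply !![1, 0; 0, 0], act_apply !![0, 0; 0, 1]]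
  simp

theorem step_one (C : ℤ → Matrix.unitaryGroup (Fin 2) ℂ) (f : ℤ → Spinor) (x : ℤ) :
    step C f x 1 = act (C (x - 1) : Matrix (Fin 2) (Fin 2) ℂ) (f (x - 1)) 1 := by
  simp only [step, leftWeight, rightWeight, act_mul, PiLp.add_apply]
  rw [act_apply !![1, 0; 0, 0], act_apply !![0, 0; 0, 1]]
  simp

theorem norm_act (C : Matrix.unitaryGroup (Fin 2) ℂ) (v : Spinor) :
    ‖act (C : Matrix (Fin 2) (Fin 2) ℂ) v‖ = ‖v‖ := by
  have adj : ∀ w : Spinor, inner ℂ (act (C : Matrix (Fin 2) (Fin 2) ℂ) v) w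
      = inner ℂ v (act (star (C : Matrix (Fin 2) (Fin 2) ℂ)) w) := by
    intro w
    simp only [PiLp.inner_apply, Fin.sum_univ_two, act_apply, RCLike.inner_apply]
    simp [Matrix.star_apply]
    ring
  have h := adj (act (C : Matrix (Fin 2) (Fin 2) ℂ) v)
  rw [← act_mul, Matrix.UnitaryGroup.star_mul_self, act_one,
    inner_self_eq_norm_sq_to_K, inner_self_eq_norm_sq_to_K] at h
  have h2 : ‖act (C : Matrix (Fin 2) (Fin 2) ℂ) v‖ ^ 2 = ‖v‖ ^ 2 := by exact_mod_cast h
  exact (sq_eq_sq₀ (norm_nonneg _) (norm_nonneg _)).1 h2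

theorem norm_sq_spinor (v : Spinor) : ‖v‖ ^ 2 = ‖v 0‖ ^ 2 + ‖v 1‖ ^ 2 := by
  rw [EuclideanSpace.norm_sq_eq, Fin.sum_univ_two]

theorem hasSum_step (C : ℤ → Matrix.unitaryGroup (Fin 2) ℂ) (f : ℤ → Spinor)
    (hf : Summable (fun x => ‖f x‖ ^ 2)) :
    HasSum (fun x => ‖step C f x‖ ^ 2) (∑' x, ‖f x‖ ^ 2) := by
  let g : ℤ → Spinor := fun x => act (C x : Matrix (Fin 2) (Fin 2) ℂ) (f x)
  have e : ∀ x, ‖f x‖ ^ 2 = ‖g x 0‖ ^ 2 + ‖g x 1‖ ^ 2 := fun x => by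
    rw [← norm_sq_spinor, norm_act]
  have h0 : Summable fun x => ‖g x 0‖ ^ 2 :=
    hf.of_nonneg_of_le (fun _ => by positivity) fun x => by rw [e]; linarith [sq_nonneg ‖g x 1‖]
  have h1 : Summable fun x => ‖g x 1‖ ^ 2 :=
    hf.of_nonneg_of_le (fun _ => by positivity) fun x => by rw [e]; linarith [sq_nonneg ‖g x 0‖]
  have k0 := (Equiv.addRight (1 : ℤ)).hasSum_iff.2 h0.hasSum
  have k1 := (Equiv.subRight (1 : ℤ)).hasSum_iff.2 h1.hasSum
  have k := k0.add k1
  rw [← h0.tsum_add h1] at k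
  simp only [e, norm_sq_spinor (step C f _), step_zero, step_one]
  exact k

theorem step_stepInv (C : ℤ → Matrix.unitaryGroup (Fin 2) ℂ) (f : ℤ → Spinor) :
    step C (stepInv C f) = f := by
  have key : ∀ (x : ℤ) (v : Spinor), act (C x : Matrix (Fin 2) (Fin 2) ℂ)
      (act (star (C x : Matrix (Fin 2) (Fin 2) ℂ)) v) = v := fun x v => by
    rw [← act_mul, Unitary.mul_star_self_of_mem (C x).2, act_one]
  funext x
  ext i
  fin_cases i
  · simp [step_zero, stepInv, key]
  · simp [step_one, stepInv, key]

theorem summable_stepInv (C : ℤ → Matrix.unitaryGroup (Fin 2) ℂ) (f : ℤ → Spinor)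
    (hf : Summable (fun x => ‖f x‖ ^ 2)) : Summable (fun x => ‖stepInv C f x‖ ^ 2) := by
  have h0 : Summable fun x => ‖f x 0‖ ^ 2 :=
    hf.of_nonneg_of_le (fun _ => by positivity) fun x => by
      rw [norm_sq_spinor]; linarith [sq_nonneg ‖f x 1‖]
  have h1 : Summable fun x => ‖f x 1‖ ^ 2 :=
    hf.of_nonneg_of_le (fun _ => by positivity) fun x => by
      rw [norm_sq_spinor]; linarith [sq_nonneg ‖f x 0‖]
  have k0 := (Equiv.subRight (1 : ℤ)).summable_iff.2 h0
  have k1 := (Equiv.addRight (1 : ℤ)).summable_iff.2 h1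
  refine (k0.add k1).congr fun x => ?_
  have := norm_act (star (C x)) (WithLp.toLp 2 ![f (x - 1) 0, f (x + 1) 1])
  rw [stepInv]
  erw [this]
  rw [norm_sq_spinor]
  simp

theorem memlp_iff (f : ℤ → Spinor) : Memℓp f 2 ↔ Summable fun x => ‖f x‖ ^ 2 := by
  rw [memℓp_gen_iff (by norm_num)]
  norm_num

theorem norm_sq_state (ψ : StateSpace) : ‖ψ‖ ^ 2 = ∑' x, ‖ψ x‖ ^ 2 := by
  have := lp.norm_rpow_eq_tsum (p := 2) (by norm_num) ψ
  simpa using this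

/-- The time evolution of the walk with coins `C`, as a linear isometry of `ℓ²(ℤ; ℂ²)`. -/
def evolutionIsometry (C : ℤ → Matrix.unitaryGroup (Fin 2) ℂ) : StateSpace →ₗᵢ[ℂ] StateSpace where
  toFun ψ := ⟨step C ψ, (memlp_iff _).2 (hasSum_step C ψ ((memlp_iff _).1 ψ.2)).summable⟩
  map_add' ψ φ := by
    ext1
    funext x
    change step C (fun y => ψ y + φ y) x = step C ψ x + step C φ x
    simp only [step, map_add]
    exact add_add_add_comm _ _ _ _
  map_smul' z ψ := by
    ext1
    funext x
    simp [step]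
  norm_map' ψ := by
    refine (sq_eq_sq₀ (norm_nonneg _) (norm_nonneg _)).1 ?_
    rw [norm_sq_state, norm_sq_state]
    exact (hasSum_step C ψ ((memlp_iff _).1 ψ.2)).tsum_eq

/-- The time evolution of the walk with coins `C`, as a unitary operator on `ℓ²(ℤ; ℂ²)`. -/
def evolution (C : ℤ → Matrix.unitaryGroup (Fin 2) ℂ) : StateSpace ≃ₗᵢ[ℂ] StateSpace :=
  LinearIsometryEquiv.ofSurjective (evolutionIsometry C) fun φ =>
    ⟨⟨stepInv C φ, (memlp_iff _).2 (summable_stepInv C φ ((memlp_iff _).1 φ.2))⟩, by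
      ext1
      exact step_stepInv C φ⟩

theorem evolution_apply (C : ℤ → Matrix.unitaryGroup (Fin 2) ℂ) (ψ : StateSpace) (x : ℤ) :
    evolution C ψ x = act (leftWeight (C (x + 1))) (ψ (x + 1))
      + act (rightWeight (C (x - 1))) (ψ (x - 1)) := rfl


/-! ### The Fourier transform -/

/-- The flat torus `ℝ / 2πℤ`. Its `volume` is the Lebesgue measure `dξ`, of total mass `2π`, and
`fourier n ξ` is `e^{inξ}`. -/
abbrev Torus : Type := AddCircle (2 * Real.pi)

instance instFactTwoPiPos : Fact (0 < 2 * Real.pi) := ⟨Real.two_pi_pos⟩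

/-- The Hilbert space `L²(𝕋; ℂ²)` with respect to `dξ`. -/
abbrev MomentumSpace : Type := Lp Spinor 2 (volume : Measure Torus)

theorem fourier_coe_eq (n : ℤ) (t : ℝ) :
    (fourier n (t : Torus) : ℂ) = Complex.exp (n * t * Complex.I) := by
  rw [fourier_coe_apply]
  congr 1
  have : (Real.pi : ℂ) ≠ 0 := by exact_mod_cast Real.pi_ne_zero
  push_cast
  field_simp

/-- The function `ξ ↦ (2π)^{-1/2} e^{-ixξ} v`, the Fourier transform of `δ_x v`. -/
def mode (x : ℤ) (v : Spinor) : C(Torus, Spinor) where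
  toFun ξ := (((Real.sqrt (2 * Real.pi))⁻¹ : ℝ) : ℂ) • (fourier (-x) ξ : ℂ) • v
  continuous_toFun := by fun_prop

theorem inner_mode (x y : ℤ) (v w : Spinor) :
    inner ℂ (ContinuousMap.toLp 2 (volume : Measure Torus) ℂ (mode x v))
      (ContinuousMap.toLp 2 (volume : Measure Torus) ℂ (mode y w))
      = if x = y then inner ℂ v w else 0 := by
  have hc : ((((Real.sqrt (2 * Real.pi))⁻¹ : ℝ) : ℂ)) * (((Real.sqrt (2 * Real.pi))⁻¹ : ℝ) : ℂ)
      = (((2 * Real.pi)⁻¹ : ℝ) : ℂ) := by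
    rw [← Complex.ofReal_mul, ← mul_inv, Real.mul_self_sqrt Real.two_pi_pos.le]
  have h1 : (fun ξ : Torus => inner ℂ (ContinuousMap.toLp 2 (volume : Measure Torus) ℂ (mode x v) ξ)
      (ContinuousMap.toLp 2 (volume : Measure Torus) ℂ (mode y w) ξ)) =ᵐ[volume]
      fun ξ => (((2 * Real.pi)⁻¹ : ℝ) : ℂ) * inner ℂ v w * (fourier (-(-x)) ξ * fourier (-y) ξ) := by
    filter_upwards [ContinuousMap.coeFn_toLp (p := 2) (𝕜 := ℂ) (volume : Measure Torus) (mode x v),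
      ContinuousMap.coeFn_toLp (p := 2) (𝕜 := ℂ) (volume : Measure Torus) (mode y w)] with ξ hx hy
    rw [hx, hy, ← hc, fourier_neg (n := -x)]
    simp only [mode, ContinuousMap.coe_mk, inner_smul_left, inner_smul_right, Complex.conj_ofReal]
    ring
  rw [L2.inner_def, integral_congr_ae h1, integral_const_mul]
  have h2 := fourierCoeff_fourier (T := 2 * Real.pi) (-y)
  have h3 := congrFun h2 (-x)
  rw [fourierCoeff, AddCircle.integral_haarAddCircle] at h3
  simp only [smul_eq_mul] at h3
  have h4 : (((2 * Real.pi)⁻¹ : ℝ) : ℂ) * ∫ ξ : Torus, fourier (-(-x)) ξ * fourier (-y) ξ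
      = if x = y then 1 else 0 := by
    rw [Complex.real_smul] at h3
    rw [h3, Pi.single_apply]
    simp [neg_inj]
  rw [mul_right_comm, h4]
  split_ifs <;> simp

/-- `v ↦ (2π)^{-1/2} e^{-ixξ} v` as an isometry `ℂ² → L²(𝕋; ℂ²)`. -/
def modeIsometry (x : ℤ) : Spinor →ₗᵢ[ℂ] MomentumSpace where
  toFun v := ContinuousMap.toLp 2 (volume : Measure Torus) ℂ (mode x v)
  map_add' v w := by
    rw [← map_add]
    congr 1
    ext1 ξ
    simp [mode, smul_add]
  map_smul' z v := by
    rw [RingHom.id_apply, ← map_smul]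
    congr 1
    ext1 ξ
    simp only [mode, ContinuousMap.coe_mk, ContinuousMap.smul_apply]
    rw [smul_comm z, smul_comm z]
  norm_map' v := by
    have h := inner_mode x x v v
    rw [if_pos rfl, inner_self_eq_norm_sq_to_K, inner_self_eq_norm_sq_to_K] at h
    exact (sq_eq_sq₀ (norm_nonneg _) (norm_nonneg _)).1 (by exact_mod_cast h)

theorem isHilbertSum_mode : IsHilbertSum ℂ (fun _ : ℤ => Spinor) modeIsometry := by
  refine IsHilbertSum.mk (fun x y hxy v w => (inner_mode x y v w).trans (if_neg hxy)) ?_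
  rw [top_le_iff, Submodule.topologicalClosure_eq_top_iff, Submodule.eq_bot_iff]
  intro f hf
  have hJ : ∀ J : Fin 2, (fun ξ => f ξ J) =ᵐ[(volume : Measure Torus)] 0 := by
    intro J
    have hm : MemLp (fun ξ => f ξ J) 2 (volume : Measure Torus) :=
      (EuclideanSpace.proj (𝕜 := ℂ) J).comp_memLp' (Lp.memLp f)
    let g := hm.haarAddCircle.toLp
    have hg : g = 0 := by
      apply (fourierBasis (T := 2 * Real.pi)).repr.injective
      rw [map_zero]
      ext n
      rw [fourierBasis_repr]
      have hn := (Submodule.mem_orthogonal _ _).1 hf (modeIsometry (-n) (ket J))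
        (Submodule.mem_iSup_of_mem (-n) ⟨_, rfl⟩)
      rw [L2.inner_def] at hn
      have h1 : (fun ξ : Torus => inner ℂ (modeIsometry (-n) (ket J) ξ) (f ξ)) =ᵐ[volume]
          fun ξ => (((Real.sqrt (2 * Real.pi))⁻¹ : ℝ) : ℂ) * (fourier (-n) ξ * f ξ J) := by
        filter_upwards [ContinuousMap.coeFn_toLp (p := 2) (𝕜 := ℂ) (volume : Measure Torus)
          (mode (-n) (ket J))] with ξ hx
        change inner ℂ (ContinuousMap.toLp 2 (volume : Measure Torus) ℂ (mode (-n) (ket J)) ξ) _ = _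
        rw [hx]
        simp only [mode, ContinuousMap.coe_mk, inner_smul_left, Complex.conj_ofReal, ket,
          EuclideanSpace.inner_single_left, fourier_neg, Complex.conj_conj]
        simp
      rw [integral_congr_ae h1, integral_const_mul] at hn
      have hc : (((Real.sqrt (2 * Real.pi))⁻¹ : ℝ) : ℂ) ≠ 0 := by
        exact_mod_cast inv_ne_zero (Real.sqrt_ne_zero'.2 Real.two_pi_pos)
      have hz := (mul_eq_zero.1 hn).resolve_left hc
      have h2 : fourierCoeff (g : Torus → ℂ) n = fourierCoeff (fun ξ : Torus => f ξ J) n :=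
        integral_congr_ae (hm.haarAddCircle.coeFn_toLp.mono fun ξ h => by
          change _ • g ξ = _ • _
          rw [h])
      rw [h2, fourierCoeff, AddCircle.integral_haarAddCircle]
      simp only [smul_eq_mul]
      rw [hz, smul_zero]
      rfl
    have h3 : (fun ξ => f ξ J) =ᵐ[AddCircle.haarAddCircle (T := 2 * Real.pi)] 0 := by
      refine hm.haarAddCircle.coeFn_toLp.symm.trans ?_
      change (g : Torus → ℂ) =ᵐ[_] 0
      rw [hg]
      exact Lp.coeFn_zero _ _ _
    have h4 : ∀ᵐ ξ ∂(ENNReal.ofReal (2 * Real.pi) •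
        AddCircle.haarAddCircle (T := 2 * Real.pi)), f ξ J = 0 := Measure.ae_smul_measure h3 _
    exact h4
  refine Lp.ext ?_
  filter_upwards [hJ 0, hJ 1, Lp.coeFn_zero Spinor 2 (volume : Measure Torus)] with ξ h0 h1 h2
  rw [h2]
  ext J
  fin_cases J
  · exact h0
  · exact h1

/-- The unitary Fourier transform `𝒰 : ℓ²(ℤ; ℂ²) → L²(𝕋; ℂ²)`,
`(𝒰 f)(ξ) = (2π)^{-1/2} ∑ₓ e^{-ixξ} f(x)`, the series converging in `L²(𝕋; ℂ²)`. -/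
def fourierTransform : StateSpace ≃ₗᵢ[ℂ] MomentumSpace :=
  isHilbertSum_mode.linearIsometryEquiv.symm

theorem hasSum_fourierTransform (ψ : StateSpace) :
    HasSum (fun x : ℤ => modeIsometry x (ψ x)) (fourierTransform ψ) :=
  isHilbertSum_mode.hasSum_linearIsometryEquiv_symm ψ

/-- The operator `𝒰 A 𝒰⁻¹` on `L²(𝕋; ℂ²)`. -/
def momentumConj (A : StateSpace →L[ℂ] StateSpace) : MomentumSpace →L[ℂ] MomentumSpace :=
  (fourierTransform : StateSpace →L[ℂ] MomentumSpace) ∘L A ∘L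
    (fourierTransform.symm : MomentumSpace →L[ℂ] StateSpace)

/-! ### Impurities and the scattering operator -/

/-- The coin is `C` on `{0, …, M-1}` and the identity elsewhere. -/
def impurityCoin (M : ℕ) (C : Matrix.unitaryGroup (Fin 2) ℂ) (x : ℤ) :
    Matrix.unitaryGroup (Fin 2) ℂ :=
  if 0 ≤ x ∧ x < M then C else 1

/-- The walk `U` with impurities on `{0, …, M-1}`. -/
def impurityWalk (M : ℕ) (C : Matrix.unitaryGroup (Fin 2) ℂ) : StateSpace ≃ₗᵢ[ℂ] StateSpace :=
  evolution (impurityCoin M C)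

/-- The free walk `U₀`: every coin is the identity. -/
def freeWalk : StateSpace ≃ₗᵢ[ℂ] StateSpace := evolution fun _ => 1

/-- `W` is the strong limit of `U^{-t} U₀^t` along `l`; the wave operators `W₊` and `W₋` are the
cases `l = atTop` and `l = atBot`. -/
def IsWaveOperator (U U₀ : StateSpace ≃ₗᵢ[ℂ] StateSpace) (l : Filter ℤ)
    (W : StateSpace →L[ℂ] StateSpace) : Prop :=
  ∀ ψ : StateSpace, Tendsto (fun t : ℤ => (U ^ (-t)) ((U₀ ^ t) ψ)) l (𝓝 (W ψ))

/-- The scattering operator `Σ = W₊* W₋`. -/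
def scatteringOperator (Wp Wm : StateSpace →L[ℂ] StateSpace) : StateSpace →L[ℂ] StateSpace :=
  ContinuousLinearMap.adjoint Wp ∘L Wm

/-! ### The explicit coefficients -/

/-- The matrix `E_M` of the compression of `U` to the impurities, with entries
`⟨δ_x |J⟩, U δ_{x'} |J'⟩⟩` for `x, x' ∈ {0, …, M-1}`. -/
def impurityBlock (M : ℕ) (C : Matrix.unitaryGroup (Fin 2) ℂ) :
    Matrix (Fin M × Fin 2) (Fin M × Fin 2) ℂ :=
  Matrix.of fun p q => inner ℂ (delta p.1 p.2) (impurityWalk M C (delta q.1 q.2))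

/-- The matrix `1 - (e^{-iξ} E_M)²`. -/
def impurityDenominator (M : ℕ) (C : Matrix.unitaryGroup (Fin 2) ℂ) (ξ : Torus) :
    Matrix (Fin M × Fin 2) (Fin M × Fin 2) ℂ :=
  1 - ((fourier (-1) ξ : ℂ) • impurityBlock M C) ^ 2

/-- `G_M(ξ) = (1 - (e^{-iξ} E_M)²)⁻¹`. -/
def impurityGreen (M : ℕ) (C : Matrix.unitaryGroup (Fin 2) ℂ) (ξ : Torus) :
    Matrix (Fin M × Fin 2) (Fin M × Fin 2) ℂ :=
  (impurityDenominator M C ξ)⁻¹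

/-- The site `0`. -/
def firstSite (M : ℕ) [NeZero M] : Fin M := ⟨0, NeZero.pos M⟩

/-- The site `M - 1`. -/
def lastSite (M : ℕ) [NeZero M] : Fin M := ⟨M - 1, Nat.sub_lt (NeZero.pos M) one_pos⟩

/-- `â_M(ξ) = a (E_M^{M-1} G_M(ξ))_{(0;L),(M-1;L)}`. -/
def aHat (M : ℕ) [NeZero M] (C : Matrix.unitaryGroup (Fin 2) ℂ) (ξ : Torus) : ℂ :=
  C.1 0 0 * (impurityBlock M C ^ (M - 1) * impurityGreen M C ξ) (firstSite M, 0) (lastSite M, 0)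

/-- `b̂_M(ξ) = b + a ((e^{-iξ} E_M)² G_M(ξ))_{(0;L),(0;R)}`. -/
def bHat (M : ℕ) [NeZero M] (C : Matrix.unitaryGroup (Fin 2) ℂ) (ξ : Torus) : ℂ :=
  C.1 0 1 + C.1 0 0 * (((fourier (-1) ξ : ℂ) • impurityBlock M C) ^ 2 * impurityGreen M C ξ)
    (firstSite M, 0) (firstSite M, 1)

/-- `ĉ_M(ξ) = (c + d ((e^{iξ} E_M)² G_M(-ξ))_{(M-1;R),(M-1;L)}) e^{-2iξ(M-1)}`. -/
def cHat (M : ℕ) [NeZero M] (C : Matrix.unitaryGroup (Fin 2) ℂ) (ξ : Torus) : ℂ :=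
  (C.1 1 0 + C.1 1 1 * (((fourier 1 ξ : ℂ) • impurityBlock M C) ^ 2 * impurityGreen M C (-ξ))
    (lastSite M, 1) (lastSite M, 0)) * (fourier (-2 * ((M : ℤ) - 1)) ξ : ℂ)

/-- `d̂_M(ξ) = d (E_M^{M-1} G_M(-ξ))_{(M-1;R),(0;R)}`. -/
def dHat (M : ℕ) [NeZero M] (C : Matrix.unitaryGroup (Fin 2) ℂ) (ξ : Torus) : ℂ :=
  C.1 1 1 * (impurityBlock M C ^ (M - 1) * impurityGreen M C (-ξ)) (lastSite M, 1) (firstSite M, 1)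

/-- `[[â_M(ξ), 0], [0, d̂_M(ξ)]]`. -/
def transmissionMatrix (M : ℕ) [NeZero M] (C : Matrix.unitaryGroup (Fin 2) ℂ) (ξ : Torus) :
    Matrix (Fin 2) (Fin 2) ℂ :=
  !![aHat M C ξ, 0; 0, dHat M C ξ]

/-- `[[0, b̂_M(ξ)], [ĉ_M(ξ), 0]]`. -/
def reflectionMatrix (M : ℕ) [NeZero M] (C : Matrix.unitaryGroup (Fin 2) ℂ) (ξ : Torus) :
    Matrix (Fin 2) (Fin 2) ℂ :=
  !![0, bHat M C ξ; cHat M C ξ, 0]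

/-! ### The energy fibres and the scattering matrix -/

/-- The symbol `Û₀(ξ) = diag(e^{iξ}, e^{-iξ})` of the free walk. -/
def freeSymbol (ξ : Torus) : Matrix (Fin 2) (Fin 2) ℂ :=
  !![(fourier 1 ξ : ℂ), 0; 0, (fourier (-1) ξ : ℂ)]

/-- `M(θ) = {ξ ∈ 𝕋 : det (Û₀(ξ) - e^{iθ}) = 0}`. -/
def momentumSet (θ : ℝ) : Set Torus :=
  {ξ | (freeSymbol ξ - Complex.exp (θ * Complex.I) • (1 : Matrix (Fin 2) (Fin 2) ℂ)).det = 0}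

theorem mem_momentumSet_iff (θ : ℝ) (ξ : Torus) : ξ ∈ momentumSet θ ↔
    ((fourier 1 ξ : ℂ) - Complex.exp (θ * Complex.I)) *
      ((fourier (-1) ξ : ℂ) - Complex.exp (θ * Complex.I)) = 0 := by
  unfold momentumSet freeSymbol
  change Matrix.det _ = 0 ↔ _
  rw [Matrix.det_fin_two]
  simp

theorem neg_mem_momentumSet {θ : ℝ} {ξ : Torus} (h : ξ ∈ momentumSet θ) : -ξ ∈ momentumSet θ := by
  rw [mem_momentumSet_iff] at h ⊢
  have h1 : (fourier 1 (-ξ) : ℂ) = fourier (-1) ξ := by simp [fourier_apply]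
  have h2 : (fourier (-1) (-ξ) : ℂ) = fourier 1 ξ := by simp [fourier_apply]
  rw [h1, h2, mul_comm, h]

theorem arccos_cos_mem_momentumSet (θ : ℝ) :
    ((Real.arccos (Real.cos θ) : ℝ) : Torus) ∈ momentumSet θ := by
  rw [mem_momentumSet_iff, fourier_coe_eq, fourier_coe_eq]
  have hcos : Real.cos (Real.arccos (Real.cos θ)) = Real.cos θ :=
    Real.cos_arccos (Real.neg_one_le_cos θ) (Real.cos_le_one θ)
  have hcos' : Complex.cos (Real.arccos (Real.cos θ)) = Complex.cos θ := by exact_mod_cast hcos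
  have hz : ∀ z : ℂ, Complex.exp (z * Complex.I) + Complex.exp (-z * Complex.I)
      = 2 * Complex.cos z := fun z => by rw [Complex.cos]; ring
  have hm : ∀ z : ℂ, Complex.exp (z * Complex.I) * Complex.exp (-z * Complex.I) = 1 := fun z => by
    rw [← Complex.exp_add]; simp
  have h1 := hz (Real.arccos (Real.cos θ))
  have h2 := hz θ
  rw [hcos', ← h2] at h1
  have h3 := hm (Real.arccos (Real.cos θ))
  have h4 := hm θ
  push_cast
  rw [one_mul, neg_one_mul]
  linear_combination h3 - h4 - Complex.exp (θ * Complex.I) * h1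

/-- The points `ξ₊(θ) = arccos (cos θ)` (for `s = true`) and `ξ₋(θ) = 2π - arccos (cos θ)` (for
`s = false`) of `M(θ)`. -/
def branch (θ : ℝ) : Bool → momentumSet θ
  | true => ⟨((Real.arccos (Real.cos θ) : ℝ) : Torus), arccos_cos_mem_momentumSet θ⟩
  | false => ⟨((2 * Real.pi - Real.arccos (Real.cos θ) : ℝ) : Torus), by
      rw [sub_eq_add_neg, AddCircle.coe_add, AddCircle.coe_period, zero_add, AddCircle.coe_neg]
      exact neg_mem_momentumSet (arccos_cos_mem_momentumSet θ)⟩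

/-- The reflection `ξ ↦ -ξ` on `M(θ)`. -/
def negPoint {θ : ℝ} (ξ : momentumSet θ) : momentumSet θ := ⟨-ξ.1, neg_mem_momentumSet ξ.2⟩

/-- The space `h(θ)` of functions `ψ = ψ₊ e₊ + ψ₋ e₋` on `M(θ)`, that is of all functions
`M(θ) → ℂ²`. -/
abbrev Fibre (θ : ℝ) : Type := momentumSet θ → Spinor

/-- The component of `f ∈ L²(𝕋; ℂ²)` in `h(θ)`, its restriction to `M(θ)`. Changing `f` on a null
set changes it only for a null set of `θ`. -/
def fibreRestrict (θ : ℝ) (f : MomentumSpace) : Fibre θ := fun ξ => f ξ.1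

/-- `S` is a family of fibre operators of `A`: in the decomposition of `L²(𝕋; ℂ²)` along the
fibres `h(θ)`, the operator `A` acts as `S(θ)` on `h(θ)` for almost every `θ ∈ [0, 2π]`. The
scattering matrix is the family of fibre operators of `𝒰 Σ 𝒰⁻¹`. -/
def IsFibreFamily (A : MomentumSpace →L[ℂ] MomentumSpace)
    (S : (θ : ℝ) → Fibre θ →ₗ[ℂ] Fibre θ) : Prop :=
  ∀ f : MomentumSpace, ∀ᵐ θ ∂(volume.restrict (Set.Icc (0 : ℝ) (2 * Real.pi))),
    fibreRestrict θ (A f) = S θ (fibreRestrict θ f)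

end QuantumWalk

end

open QuantumWalk MeasureTheory Filter

/-!
A scattering state enters the impurities at one end with one chirality. The state
`δ_{M-1}|L⟩` enters from the right and `δ_0|R⟩` from the left; neither has met an impurity before
time `0`, so `W₋` fixes both (`IsWaveOperator.map_delta_atBot`). Hence `Σ = W₊* W₋` acts on them as
`W₊*`, and it is enough to compute `W₊* δ_p` for the basis states `δ_p` on the impurities.

One step of the walk decomposes `U δ_p` into its part `E δ_p` on the impurities and multiples of
the escaping states `δ_{-1}|L⟩` and `δ_M|R⟩` (`impurityWalk_embed`). The latter are fixed by `W₊`,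
and `W₊* U = U₀ W₊*`, so the `W₊* δ_p` satisfy a finite linear system (`freeWalk_adjoint_delta`). In
momentum space `U₀` is multiplication by `diag(e^{iξ}, e^{-iξ})`, and the system becomes, at almost
every `ξ`, one equation with matrix `1 - e^{-iξ} E` for the `L` components and one with matrix
`1 - e^{iξ} E` for the `R` components (`fourierTransform_adjoint_delta`). These matrices are
invertible: a vector on which `E` acts by a unimodular scalar never leaves the impurities, and since
`a ≠ 0` it vanishes site by site (`eq_zero_of_smul_mulVec_eq`). The entries of their inverses are
the stated coefficients: `(1 - zE)⁻¹ = (1 + zE) (1 - (zE)²)⁻¹`, one of the two terms vanishes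
because `E` exchanges even and odd sites, and finite propagation speed removes the first `M - 1`
terms of the Neumann series in the transmission entries (`resolvent_apply_of_same_site`,
`resolvent_apply_of_dist`).

Both sides of the formula for `Σ` commute with the free walk, which carries the two incoming
states to all basis states (`delta_add_mem_iff`). The states on which a fibrewise formula holds
almost everywhere form a closed subspace (`isClosed_fibrewiseSubspace`), so it holds for all states.

The fibre `M(θ)` consists of `±θ`, so the formula restricts to almost every fibre. The fibre
operators are unique because the functions `v` and `e^{iξ} v` with `v ∈ {|L⟩, |R⟩}` span every
fibre (`exists_interpolation`).
-/

open scoped Topology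

namespace QuantumWalk

/-! ### The walks on basis states -/

theorem state_ext {ψ φ : StateSpace} (h : ∀ (x : ℤ) (J : Fin 2), ψ x J = φ x J) : ψ = φ := by
  ext x J
  exact h x J

theorem delta_apply (x y : ℤ) (J K : Fin 2) :
    delta x J y K = if y = x ∧ K = J then 1 else 0 := by
  rw [delta, lp.single_apply]
  by_cases h : y = x
  · subst h
    simp [ket]
  · simp [h]

theorem inner_delta (x : ℤ) (J : Fin 2) (ψ : StateSpace) : inner ℂ (delta x J) ψ = ψ x J := by
  rw [delta, lp.inner_single_left, ket, EuclideanSpace.inner_single_left]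
  simp

theorem evolution_apply_zero (C : ℤ → Matrix.unitaryGroup (Fin 2) ℂ) (ψ : StateSpace) (x : ℤ) :
    evolution C ψ x 0
      = (C (x + 1)).1 0 0 * ψ (x + 1) 0 + (C (x + 1)).1 0 1 * ψ (x + 1) 1 :=
  (step_zero C ψ x).trans (act_apply _ _ _)

theorem evolution_apply_one (C : ℤ → Matrix.unitaryGroup (Fin 2) ℂ) (ψ : StateSpace) (x : ℤ) :
    evolution C ψ x 1
      = (C (x - 1)).1 1 0 * ψ (x - 1) 0 + (C (x - 1)).1 1 1 * ψ (x - 1) 1 :=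
  (step_one C ψ x).trans (act_apply _ _ _)

theorem freeWalk_apply_zero (ψ : StateSpace) (x : ℤ) : freeWalk ψ x 0 = ψ (x + 1) 0 := by
  simp [freeWalk, evolution_apply_zero]

theorem freeWalk_apply_one (ψ : StateSpace) (x : ℤ) : freeWalk ψ x 1 = ψ (x - 1) 1 := by
  simp [freeWalk, evolution_apply_one]

/-- The displacement of a free particle of chirality `J` in one step: `-1` for `L` and `1` for
`R`. -/
def velocity (J : Fin 2) : ℤ := if J = 0 then -1 else 1

theorem freeWalk_delta (x : ℤ) (J : Fin 2) : freeWalk (delta x J) = delta (x + velocity J) J := by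
  refine state_ext fun y K => ?_
  fin_cases K
  · simp only [Fin.zero_eta, freeWalk_apply_zero, delta_apply]
    fin_cases J
    · simp [velocity, ← sub_eq_add_neg, eq_sub_iff_add_eq]
    · simp
  · simp only [Fin.mk_one, freeWalk_apply_one, delta_apply]
    fin_cases J
    · simp
    · simp [velocity, sub_eq_iff_eq_add]

theorem freeWalk_zpow_delta (t : ℤ) (x : ℤ) (J : Fin 2) :
    (freeWalk ^ t) (delta x J) = delta (x + velocity J * t) J := by
  have up : ∀ t : ℤ, (freeWalk ^ (t + 1)) (delta x J) = freeWalk ((freeWalk ^ t) (delta x J)) :=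
    fun t => by rw [add_comm, zpow_one_add]; rfl
  induction t using Int.induction_on with
  | zero => simp
  | succ n ih => rw [up, ih, freeWalk_delta]; congr 1; ring
  | pred n ih =>
    apply freeWalk.injective
    rw [← up, sub_add_cancel, ih, freeWalk_delta]
    congr 1; ring

/-- Outside the impurities the walk moves basis states as the free walk does. -/
theorem impurityWalk_delta_eq_freeWalk (M : ℕ) (C : Matrix.unitaryGroup (Fin 2) ℂ) {x : ℤ}
    (hx : ¬ (0 ≤ x ∧ x < M)) (J : Fin 2) :
    impurityWalk M C (delta x J) = freeWalk (delta x J) := by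
  have coin : ∀ y K (i : Fin 2), (impurityCoin M C y).1 i K * delta x J y K
      = (1 : Matrix (Fin 2) (Fin 2) ℂ) i K * delta x J y K := by
    intro y K i
    rw [delta_apply]
    split_ifs with h
    · rw [h.1, impurityCoin, if_neg hx]
      rfl
    · simp
  refine state_ext fun y K => ?_
  fin_cases K
  · simp only [Fin.zero_eta, impurityWalk, evolution_apply_zero, coin, freeWalk_apply_zero]
    simp
  · simp only [Fin.mk_one, impurityWalk, evolution_apply_one, coin, freeWalk_apply_one]
    simp

/-! ### Wave operators -/

/-- The interaction-picture evolution `U^{-t} U₀^t`. -/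
noncomputable def interaction (U U₀ : StateSpace ≃ₗᵢ[ℂ] StateSpace) (t : ℤ) :
    StateSpace ≃ₗᵢ[ℂ] StateSpace :=
  U ^ (-t) * U₀ ^ t

theorem interaction_apply (U U₀ : StateSpace ≃ₗᵢ[ℂ] StateSpace) (t : ℤ) (ψ : StateSpace) :
    interaction U U₀ t ψ = (U ^ (-t)) ((U₀ ^ t) ψ) := rfl

theorem interaction_freeWalk (U U₀ : StateSpace ≃ₗᵢ[ℂ] StateSpace) (t : ℤ) (ψ : StateSpace) :
    interaction U U₀ t (U₀ ψ) = U (interaction U U₀ (t + 1) ψ) := by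
  have h : interaction U U₀ t * U₀ = U * interaction U U₀ (t + 1) := by
    simp only [interaction]
    group
  exact congrArg (fun V : StateSpace ≃ₗᵢ[ℂ] StateSpace => V ψ) h

/-- `U^{-t} U₀^t δ_x|J⟩` is stationary at the times at which the free particle is outside the
impurities. -/
theorem interaction_succ_delta (M : ℕ) (C : Matrix.unitaryGroup (Fin 2) ℂ) {x t : ℤ} {J : Fin 2}
    (h : ¬ (0 ≤ x + velocity J * t ∧ x + velocity J * t < M)) :
    interaction (impurityWalk M C) freeWalk (t + 1) (delta x J)
      = interaction (impurityWalk M C) freeWalk t (delta x J) := by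
  apply (impurityWalk M C).injective
  rw [← interaction_freeWalk, interaction_apply, interaction_apply]
  have comm : (freeWalk ^ t) (freeWalk (delta x J)) = freeWalk ((freeWalk ^ t) (delta x J)) :=
    congrArg (fun V : StateSpace ≃ₗᵢ[ℂ] StateSpace => V (delta x J))
      (Commute.self_zpow freeWalk t).symm.eq
  have comm' : ∀ φ, impurityWalk M C ((impurityWalk M C ^ (-t)) φ)
      = (impurityWalk M C ^ (-t)) (impurityWalk M C φ) := fun φ =>
    congrArg (fun V : StateSpace ≃ₗᵢ[ℂ] StateSpace => V φ)
      (Commute.self_zpow (impurityWalk M C) (-t)).eq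
  rw [comm, comm', freeWalk_zpow_delta, impurityWalk_delta_eq_freeWalk M C h]

theorem interaction_delta_of_forall_ge (M : ℕ) (C : Matrix.unitaryGroup (Fin 2) ℂ) {x t₀ : ℤ}
    {J : Fin 2}
    (h : ∀ t, t₀ ≤ t → ¬ (0 ≤ x + velocity J * t ∧ x + velocity J * t < M)) {t : ℤ}
    (ht : t₀ ≤ t) :
    interaction (impurityWalk M C) freeWalk t (delta x J)
      = interaction (impurityWalk M C) freeWalk t₀ (delta x J) := by
  induction t, ht using Int.leInduction with
  | base => rfl
  | succ t ht ih => rw [interaction_succ_delta M C (h t ht), ih]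

theorem interaction_delta_of_forall_lt (M : ℕ) (C : Matrix.unitaryGroup (Fin 2) ℂ) {x t₀ : ℤ}
    {J : Fin 2}
    (h : ∀ t, t < t₀ → ¬ (0 ≤ x + velocity J * t ∧ x + velocity J * t < M)) {t : ℤ}
    (ht : t ≤ t₀) :
    interaction (impurityWalk M C) freeWalk t (delta x J)
      = interaction (impurityWalk M C) freeWalk t₀ (delta x J) := by
  induction t, ht using Int.leInductionDown with
  | base => rfl
  | pred t ht ih =>
    rw [← ih, ← interaction_succ_delta M C (h (t - 1) (by omega)), sub_add_cancel]

theorem velocity_eq (J : Fin 2) : velocity J = -1 ∨ velocity J = 1 := by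
  fin_cases J <;> simp [velocity]

theorem tendsto_interaction_delta_atTop (M : ℕ) (C : Matrix.unitaryGroup (Fin 2) ℂ) {x t₀ : ℤ}
    {J : Fin 2}
    (h : ∀ t, t₀ ≤ t → ¬ (0 ≤ x + velocity J * t ∧ x + velocity J * t < M)) :
    Tendsto (fun t => interaction (impurityWalk M C) freeWalk t (delta x J)) atTop
      (𝓝 (interaction (impurityWalk M C) freeWalk t₀ (delta x J))) :=
  tendsto_const_nhds.congr' <| (eventually_ge_atTop t₀).mono fun _ ht =>
    (interaction_delta_of_forall_ge M C h ht).symm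

theorem tendsto_interaction_delta_atBot (M : ℕ) (C : Matrix.unitaryGroup (Fin 2) ℂ) {x t₀ : ℤ}
    {J : Fin 2}
    (h : ∀ t, t < t₀ → ¬ (0 ≤ x + velocity J * t ∧ x + velocity J * t < M)) :
    Tendsto (fun t => interaction (impurityWalk M C) freeWalk t (delta x J)) atBot
      (𝓝 (interaction (impurityWalk M C) freeWalk t₀ (delta x J))) :=
  tendsto_const_nhds.congr' <| (eventually_le_atBot t₀).mono fun _ ht =>
    (interaction_delta_of_forall_lt M C h ht).symm

theorem eq_sum_ket (v : Spinor) : v = ∑ J, v J • ket J := by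
  ext K
  fin_cases K <;> simp [ket, Fin.sum_univ_two]

/-- A closed subspace of `ℓ²(ℤ; ℂ²)` that contains all basis states is the whole space. -/
theorem eq_top_of_delta_mem {V : Submodule ℂ StateSpace} (hV : IsClosed (V : Set StateSpace))
    (h : ∀ x J, delta x J ∈ V) : V = ⊤ := by
  rw [Submodule.eq_top_iff']
  intro ψ
  refine hV.mem_of_tendsto (lp.hasSum_single (by norm_num) ψ) (Eventually.of_forall fun s => ?_)
  refine V.sum_mem fun x _ => ?_
  have e : lp.single 2 x (ψ x) = ∑ J, (ψ x) J • delta x J := by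
    conv_lhs => rw [eq_sum_ket (ψ x)]
    simp only [Fin.sum_univ_two, lp.single_add, lp.single_smul, delta]
  rw [e]
  exact V.sum_mem fun J _ => V.smul_mem _ (h x J)

/-- The vectors along whose orbit a family of isometries converges form a subspace. -/
def convergenceSubspace (T : ℤ → StateSpace ≃ₗᵢ[ℂ] StateSpace) (l : Filter ℤ) :
    Submodule ℂ StateSpace where
  carrier := {ψ | ∃ φ, Tendsto (fun t => T t ψ) l (𝓝 φ)}
  add_mem' := by
    rintro a b ⟨φ, hφ⟩ ⟨χ, hχ⟩
    exact ⟨φ + χ, by simpa using hφ.add hχ⟩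
  zero_mem' := ⟨0, by simp [tendsto_const_nhds]⟩
  smul_mem' := by
    rintro z a ⟨φ, hφ⟩
    exact ⟨z • φ, by simpa using hφ.const_smul z⟩

theorem isClosed_convergenceSubspace (T : ℤ → StateSpace ≃ₗᵢ[ℂ] StateSpace) (l : Filter ℤ)
    [l.NeBot] : IsClosed (convergenceSubspace T l : Set StateSpace) := by
  refine isClosed_of_closure_subset fun ψ hψ => ?_
  change ∃ φ, Tendsto (fun t => T t ψ) l (𝓝 φ)
  rw [← cauchy_map_iff_exists_tendsto, Metric.cauchy_iff]
  refine ⟨inferInstance, fun ε hε => ?_⟩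
  obtain ⟨χ, ⟨φ, hφ⟩, hχ⟩ := Metric.mem_closure_iff.1 hψ (ε / 4) (by positivity)
  refine ⟨Metric.ball φ (ε / 2), ?_, fun a ha b hb => ?_⟩
  · rw [mem_map]
    filter_upwards [Metric.tendsto_nhds.1 hφ (ε / 4) (by positivity)] with t ht
    have h1 := (T t).dist_map ψ χ
    have h2 := dist_triangle (T t ψ) (T t χ) φ
    exact Metric.mem_ball.2 (by linarith)
  · have h1 := dist_triangle_right a b φ
    have h2 := Metric.mem_ball.1 ha
    have h3 := Metric.mem_ball.1 hb
    linarith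

/-- If `U^{-t} U₀^t` converges on every basis state, the wave operator exists. -/
theorem exists_isWaveOperator {U U₀ : StateSpace ≃ₗᵢ[ℂ] StateSpace} {l : Filter ℤ} [l.NeBot]
    [l.IsCountablyGenerated]
    (h : ∀ x J, ∃ φ, Tendsto (fun t => interaction U U₀ t (delta x J)) l (𝓝 φ)) :
    ∃ W, IsWaveOperator U U₀ l W := by
  have htop := eq_top_of_delta_mem (isClosed_convergenceSubspace (interaction U U₀) l) h
  have hall : ∀ ψ, ∃ φ, Tendsto (fun t => interaction U U₀ t ψ) l (𝓝 φ) := fun ψ => by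
    have : ψ ∈ convergenceSubspace (interaction U U₀) l := htop ▸ Submodule.mem_top
    exact this
  choose W hW using hall
  exact ⟨continuousLinearMapOfTendsto
    (fun t => (interaction U U₀ t : StateSpace →L[ℂ] StateSpace)) (tendsto_pi_nhds.2 hW), hW⟩

theorem exists_isWaveOperator_atTop (M : ℕ) (C : Matrix.unitaryGroup (Fin 2) ℂ) :
    ∃ W, IsWaveOperator (impurityWalk M C) freeWalk atTop W :=
  exists_isWaveOperator fun x J => ⟨_, tendsto_interaction_delta_atTop M C (t₀ := |x| + M + 1)
    fun t ht => by
      have h1 := neg_abs_le x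
      have h2 := le_abs_self x
      rcases velocity_eq J with h | h <;> rw [h] <;> omega⟩

theorem exists_isWaveOperator_atBot (M : ℕ) (C : Matrix.unitaryGroup (Fin 2) ℂ) :
    ∃ W, IsWaveOperator (impurityWalk M C) freeWalk atBot W :=
  exists_isWaveOperator fun x J => ⟨_, tendsto_interaction_delta_atBot M C (t₀ := -(|x| + M + 1))
    fun t ht => by
      have h1 := neg_abs_le x
      have h2 := le_abs_self x
      rcases velocity_eq J with h | h <;> rw [h] <;> omega⟩

namespace IsWaveOperator

variable {U U₀ : StateSpace ≃ₗᵢ[ℂ] StateSpace} {l : Filter ℤ} {W : StateSpace →L[ℂ] StateSpace}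

theorem norm_map [l.NeBot] (hW : IsWaveOperator U U₀ l W) (ψ : StateSpace) : ‖W ψ‖ = ‖ψ‖ := by
  refine tendsto_nhds_unique (hW ψ).norm ?_
  simp

theorem adjoint_apply_self [l.NeBot] (hW : IsWaveOperator U U₀ l W) (ψ : StateSpace) :
    ContinuousLinearMap.adjoint W (W ψ) = ψ := by
  have h := W.norm_map_iff_adjoint_comp_self.1 hW.norm_map
  exact congrArg (fun V : StateSpace →L[ℂ] StateSpace => V ψ) h

/-- The intertwining relation `W U₀ = U W`. -/
theorem map_freeWalk [l.NeBot] (hW : IsWaveOperator U U₀ l W)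
    (hl : Tendsto (fun t : ℤ => t + 1) l l) (ψ : StateSpace) : W (U₀ ψ) = U (W ψ) :=
  tendsto_nhds_unique (hW (U₀ ψ)) <|
    ((U.continuous.tendsto _).comp ((hW ψ).comp hl)).congr fun t =>
      (interaction_freeWalk U U₀ t ψ).symm

theorem adjoint_map [l.NeBot] (hW : IsWaveOperator U U₀ l W)
    (hl : Tendsto (fun t : ℤ => t + 1) l l) (ψ : StateSpace) :
    ContinuousLinearMap.adjoint W (U ψ) = U₀ (ContinuousLinearMap.adjoint W ψ) := by
  refine ext_inner_right ℂ fun φ => ?_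
  obtain ⟨χ, rfl⟩ := U₀.surjective φ
  rw [ContinuousLinearMap.adjoint_inner_left, hW.map_freeWalk hl, U.inner_map_map,
    U₀.inner_map_map, ContinuousLinearMap.adjoint_inner_left]

end IsWaveOperator

theorem tendsto_add_one_atTop_int : Tendsto (fun t : ℤ => t + 1) atTop atTop :=
  tendsto_atTop_add_const_right _ _ tendsto_id

theorem tendsto_add_one_atBot_int : Tendsto (fun t : ℤ => t + 1) atBot atBot :=
  tendsto_atBot_add_const_right _ _ tendsto_id

/-- A basis state whose free future avoids the impurities is fixed by `W₊`. -/
theorem IsWaveOperator.map_delta_atTop {M : ℕ} {C : Matrix.unitaryGroup (Fin 2) ℂ}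
    {W : StateSpace →L[ℂ] StateSpace} (hW : IsWaveOperator (impurityWalk M C) freeWalk atTop W)
    {x : ℤ} {J : Fin 2}
    (h : ∀ t, 0 ≤ t → ¬ (0 ≤ x + velocity J * t ∧ x + velocity J * t < M)) :
    W (delta x J) = delta x J := by
  refine (tendsto_nhds_unique (hW _) (tendsto_interaction_delta_atTop M C h)).trans ?_
  simp [interaction]

/-- A basis state whose free past avoids the impurities is fixed by `W₋`. -/
theorem IsWaveOperator.map_delta_atBot {M : ℕ} {C : Matrix.unitaryGroup (Fin 2) ℂ}
    {W : StateSpace →L[ℂ] StateSpace} (hW : IsWaveOperator (impurityWalk M C) freeWalk atBot W)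
    {x : ℤ} {J : Fin 2}
    (h : ∀ t, t < 0 → ¬ (0 ≤ x + velocity J * t ∧ x + velocity J * t < M)) :
    W (delta x J) = delta x J := by
  refine (tendsto_nhds_unique (hW _) (tendsto_interaction_delta_atBot M C h)).trans ?_
  simp [interaction]

/-- The scattering operator commutes with the free walk. -/
theorem scatteringOperator_freeWalk {M : ℕ} {C : Matrix.unitaryGroup (Fin 2) ℂ}
    {Wp Wm : StateSpace →L[ℂ] StateSpace}
    (hp : IsWaveOperator (impurityWalk M C) freeWalk atTop Wp)
    (hm : IsWaveOperator (impurityWalk M C) freeWalk atBot Wm) (ψ : StateSpace) :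
    scatteringOperator Wp Wm (freeWalk ψ) = freeWalk (scatteringOperator Wp Wm ψ) := by
  simp only [scatteringOperator, ContinuousLinearMap.comp_apply]
  rw [hm.map_freeWalk tendsto_add_one_atBot_int, hp.adjoint_map tendsto_add_one_atTop_int]

/-! ### States supported on the impurities -/

/-- A vector indexed by the impurities and the chiralities, as a state supported on the
impurities. -/
noncomputable def embed {M : ℕ} (v : Fin M × Fin 2 → ℂ) : StateSpace :=
  ∑ p : Fin M × Fin 2, v p • delta p.1 p.2

theorem embed_apply {M : ℕ} (v : Fin M × Fin 2 → ℂ) (x : ℤ) (J : Fin 2) :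
    embed v x J = ∑ p : Fin M × Fin 2, v p * delta p.1 p.2 x J := by
  rw [← inner_delta, embed, inner_sum]
  simp only [inner_smul_right, inner_delta]

theorem embed_apply_site {M : ℕ} (v : Fin M × Fin 2 → ℂ) (i : Fin M) (J : Fin 2) :
    embed v (i : ℤ) J = v (i, J) := by
  rw [embed_apply, Finset.sum_eq_single (i, J)]
  · simp [delta_apply]
  · rintro ⟨j, K⟩ - hne
    rw [delta_apply, if_neg, mul_zero]
    rintro ⟨h1, h2⟩
    exact hne (Prod.ext (Fin.ext (by exact_mod_cast h1.symm)) h2.symm)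
  · simp

theorem embed_apply_of_not_mem {M : ℕ} (v : Fin M × Fin 2 → ℂ) {x : ℤ} (hx : ¬ (0 ≤ x ∧ x < M))
    (J : Fin 2) : embed v x J = 0 := by
  rw [embed_apply]
  refine Finset.sum_eq_zero fun p _ => ?_
  rw [delta_apply, if_neg, mul_zero]
  rintro ⟨h, -⟩
  have := p.1.isLt
  omega

theorem embed_single {M : ℕ} (p : Fin M × Fin 2) : embed (Pi.single p 1) = delta p.1 p.2 := by
  rw [embed, Finset.sum_eq_single p]
  · simp
  · intro q _ h
    simp [h]
  · simp

theorem embed_smul {M : ℕ} (z : ℂ) (v : Fin M × Fin 2 → ℂ) : embed (z • v) = z • embed v := by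
  simp [embed, Finset.smul_sum, mul_smul]

theorem exists_site {M : ℕ} {x : ℤ} (hx : 0 ≤ x ∧ x < M) : ∃ i : Fin M, (i : ℤ) = x :=
  ⟨⟨x.toNat, by omega⟩, by simp [hx.1]⟩

theorem coe_firstSite (M : ℕ) [NeZero M] : ((firstSite M : Fin M) : ℤ) = 0 := rfl

theorem coe_lastSite (M : ℕ) [NeZero M] : ((lastSite M : Fin M) : ℤ) = (M : ℤ) - 1 := by
  have := NeZero.pos M
  simp only [lastSite]
  omega

theorem impurityCoin_site (M : ℕ) (C : Matrix.unitaryGroup (Fin 2) ℂ) (i : Fin M) :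
    impurityCoin M C (i : ℤ) = C :=
  if_pos ⟨by positivity, by exact_mod_cast i.isLt⟩

theorem impurityWalk_apply_zero (M : ℕ) (C : Matrix.unitaryGroup (Fin 2) ℂ) (ψ : StateSpace)
    (i : Fin M) {x : ℤ} (hx : x + 1 = i) :
    impurityWalk M C ψ x 0 = C.1 0 0 * ψ (i : ℤ) 0 + C.1 0 1 * ψ (i : ℤ) 1 := by
  rw [impurityWalk, evolution_apply_zero, hx, impurityCoin_site]

theorem impurityWalk_apply_one (M : ℕ) (C : Matrix.unitaryGroup (Fin 2) ℂ) (ψ : StateSpace)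
    (i : Fin M) {x : ℤ} (hx : x - 1 = i) :
    impurityWalk M C ψ x 1 = C.1 1 0 * ψ (i : ℤ) 0 + C.1 1 1 * ψ (i : ℤ) 1 := by
  rw [impurityWalk, evolution_apply_one, hx, impurityCoin_site]

theorem impurityWalk_embed_zero_eq_zero (M : ℕ) (C : Matrix.unitaryGroup (Fin 2) ℂ)
    (v : Fin M × Fin 2 → ℂ) {x : ℤ} (hx : ¬ (0 ≤ x + 1 ∧ x + 1 < M)) :
    impurityWalk M C (embed v) x 0 = 0 := by
  rw [impurityWalk, evolution_apply_zero, embed_apply_of_not_mem v hx, embed_apply_of_not_mem v hx]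
  simp

theorem impurityWalk_embed_one_eq_zero (M : ℕ) (C : Matrix.unitaryGroup (Fin 2) ℂ)
    (v : Fin M × Fin 2 → ℂ) {x : ℤ} (hx : ¬ (0 ≤ x - 1 ∧ x - 1 < M)) :
    impurityWalk M C (embed v) x 1 = 0 := by
  rw [impurityWalk, evolution_apply_one, embed_apply_of_not_mem v hx, embed_apply_of_not_mem v hx]
  simp

/-! ### The compression `E_M` -/

theorem impurityBlock_mulVec (M : ℕ) (C : Matrix.unitaryGroup (Fin 2) ℂ)
    (v : Fin M × Fin 2 → ℂ) (p : Fin M × Fin 2) :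
    (impurityBlock M C).mulVec v p = impurityWalk M C (embed v) (p.1 : ℤ) p.2 := by
  rw [← inner_delta, embed, map_sum, inner_sum]
  refine Finset.sum_congr rfl fun q _ => ?_
  rw [map_smul, inner_smul_right, mul_comm]
  rfl

/-- The amplitudes with which a vector supported on the impurities leaves them to the left and to
the right in one step. -/
noncomputable def exitAmplitude (M : ℕ) [NeZero M] (C : Matrix.unitaryGroup (Fin 2) ℂ)
    (J : Fin 2) : Fin M × Fin 2 → ℂ :=
  fun p => if p.1 = (if J = 0 then firstSite M else lastSite M) then C.1 J p.2 else 0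

theorem exitAmplitude_dotProduct (M : ℕ) [NeZero M] (C : Matrix.unitaryGroup (Fin 2) ℂ)
    (J : Fin 2) (v : Fin M × Fin 2 → ℂ) :
    exitAmplitude M C J ⬝ᵥ v = C.1 J 0 * v (if J = 0 then firstSite M else lastSite M, 0)
      + C.1 J 1 * v (if J = 0 then firstSite M else lastSite M, 1) := by
  simp only [dotProduct, Fintype.sum_prod_type, exitAmplitude, Fin.sum_univ_two]
  rw [Finset.sum_eq_single (if J = 0 then firstSite M else lastSite M)]
  · simp
  · intro i _ h
    simp [h]
  · simp

/-- One step of the walk from a state on the impurities: the part that stays, and the parts that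
leave to the left and to the right. -/
theorem impurityWalk_embed (M : ℕ) [NeZero M] (C : Matrix.unitaryGroup (Fin 2) ℂ)
    (v : Fin M × Fin 2 → ℂ) :
    impurityWalk M C (embed v) = embed ((impurityBlock M C).mulVec v)
      + ((exitAmplitude M C 0 ⬝ᵥ v) • delta (-1) 0 + (exitAmplitude M C 1 ⬝ᵥ v) • delta M 1) := by
  have hM := NeZero.pos M
  refine state_ext fun x J => ?_
  have expand : (embed ((impurityBlock M C).mulVec v)
      + ((exitAmplitude M C 0 ⬝ᵥ v) • delta (-1) 0
        + (exitAmplitude M C 1 ⬝ᵥ v) • delta M 1) : StateSpace) x J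
      = embed ((impurityBlock M C).mulVec v) x J + ((exitAmplitude M C 0 ⬝ᵥ v) * delta (-1) 0 x J
        + (exitAmplitude M C 1 ⬝ᵥ v) * delta M 1 x J) := rfl
  rw [expand]
  by_cases hx : 0 ≤ x ∧ x < M
  · obtain ⟨i, rfl⟩ := exists_site hx
    have := i.isLt
    rw [embed_apply_site, impurityBlock_mulVec, delta_apply, delta_apply, if_neg (by omega),
      if_neg (by omega)]
    simp
  · rw [embed_apply_of_not_mem _ hx, zero_add]
    by_cases hJ : J = 0
    · subst hJ
      by_cases h : x = -1
      · subst h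
        rw [impurityWalk_apply_zero M C _ (firstSite M) (by rw [coe_firstSite]; rfl),
          exitAmplitude_dotProduct, embed_apply_site, embed_apply_site]
        simp [delta_apply]
      · rw [impurityWalk_embed_zero_eq_zero M C v (by omega)]
        simp [delta_apply, h]
    · obtain rfl : J = 1 := by omega
      by_cases h : x = M
      · subst h
        rw [impurityWalk_apply_one M C _ (lastSite M) (coe_lastSite M).symm,
          exitAmplitude_dotProduct M C 1 v, embed_apply_site, embed_apply_site]
        simp [delta_apply]
      · rw [impurityWalk_embed_one_eq_zero M C v (by omega)]
        simp [delta_apply, h]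

theorem impurityBlock_apply_zero (M : ℕ) (C : Matrix.unitaryGroup (Fin 2) ℂ) (i j : Fin M)
    (J : Fin 2) :
    impurityBlock M C (i, 0) (j, J) = if (i : ℤ) + 1 = j then C.1 0 J else 0 := by
  rw [impurityBlock, Matrix.of_apply, inner_delta]
  simp only
  split_ifs with h
  · rw [impurityWalk_apply_zero M C _ j h, delta_apply, delta_apply]
    fin_cases J <;> simp
  · rw [impurityWalk, evolution_apply_zero, delta_apply, delta_apply, if_neg (by tauto),
      if_neg (by tauto)]
    simp

theorem impurityBlock_apply_one (M : ℕ) (C : Matrix.unitaryGroup (Fin 2) ℂ) (i j : Fin M)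
    (J : Fin 2) :
    impurityBlock M C (i, 1) (j, J) = if (i : ℤ) - 1 = j then C.1 1 J else 0 := by
  rw [impurityBlock, Matrix.of_apply, inner_delta]
  simp only
  split_ifs with h
  · rw [impurityWalk_apply_one M C _ j h, delta_apply, delta_apply]
    fin_cases J <;> simp
  · rw [impurityWalk, evolution_apply_one, delta_apply, delta_apply, if_neg (by tauto),
      if_neg (by tauto)]
    simp

theorem impurityBlock_apply_of_dist_ne_one (M : ℕ) (C : Matrix.unitaryGroup (Fin 2) ℂ)
    {p q : Fin M × Fin 2} (h : |(p.1 : ℤ) - q.1| ≠ 1) : impurityBlock M C p q = 0 := by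
  obtain ⟨i, I⟩ := p
  obtain ⟨j, J⟩ := q
  simp only at h
  fin_cases I
  · refine (impurityBlock_apply_zero M C i j J).trans (if_neg fun e => h ?_)
    rw [← e]; simp
  · refine (impurityBlock_apply_one M C i j J).trans (if_neg fun e => h ?_)
    rw [← e]; simp

theorem impurityBlock_firstSite (M : ℕ) [NeZero M] (C : Matrix.unitaryGroup (Fin 2) ℂ)
    (q : Fin M × Fin 2) : impurityBlock M C (firstSite M, 1) q = 0 := by
  refine (impurityBlock_apply_one M C _ q.1 q.2).trans (if_neg ?_)
  rw [coe_firstSite]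
  omega

theorem impurityBlock_lastSite (M : ℕ) [NeZero M] (C : Matrix.unitaryGroup (Fin 2) ℂ)
    (q : Fin M × Fin 2) : impurityBlock M C (lastSite M, 0) q = 0 := by
  refine (impurityBlock_apply_zero M C _ q.1 q.2).trans (if_neg ?_)
  rw [coe_lastSite]
  have := q.1.isLt
  omega

/-- Finite propagation speed. -/
theorem impurityBlock_pow_apply_eq_zero (M : ℕ) (C : Matrix.unitaryGroup (Fin 2) ℂ) (k : ℕ)
    {p q : Fin M × Fin 2} (h : (k : ℤ) < |(p.1 : ℤ) - q.1|) : (impurityBlock M C ^ k) p q = 0 := by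
  induction k generalizing p with
  | zero =>
    rw [pow_zero, Matrix.one_apply_ne]
    rintro rfl
    simp at h
  | succ k ih =>
    rw [pow_succ', Matrix.mul_apply]
    refine Finset.sum_eq_zero fun r _ => ?_
    by_cases hr : |(p.1 : ℤ) - r.1| = 1
    · rw [ih, mul_zero]
      have := abs_sub_le (p.1 : ℤ) r.1 q.1
      push_cast at h
      omega
    · rw [impurityBlock_apply_of_dist_ne_one M C hr, zero_mul]

/-- The sign `(-1)^x` of the sublattice of the site `x`. -/
noncomputable def parity (M : ℕ) : Matrix (Fin M × Fin 2) (Fin M × Fin 2) ℂ :=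
  Matrix.diagonal fun p => (-1) ^ (p.1 : ℕ)

/-- The walk exchanges the two sublattices. -/
theorem parity_mul_impurityBlock (M : ℕ) (C : Matrix.unitaryGroup (Fin 2) ℂ) :
    parity M * impurityBlock M C = -(impurityBlock M C * parity M) := by
  ext p q
  rw [Matrix.neg_apply, parity, Matrix.diagonal_mul, Matrix.mul_diagonal]
  by_cases h : |(p.1 : ℤ) - q.1| = 1
  · rcases (abs_eq zero_le_one).1 h with e | e
    · have e' : (p.1 : ℕ) = q.1 + 1 := by omega
      rw [e', pow_succ]
      ring
    · have e' : (q.1 : ℕ) = p.1 + 1 := by omega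
      rw [e', pow_succ]
      ring
  · rw [impurityBlock_apply_of_dist_ne_one M C h]
    simp

/-! ### No eigenvalue of `E_M` on the unit circle -/

/-- A vector on which `E_M` acts by a unimodular scalar does not leave the impurities; then it
vanishes site by site, starting from the left end, because `a ≠ 0`. -/
theorem eq_zero_of_smul_mulVec_eq {M : ℕ} [NeZero M] {C : Matrix.unitaryGroup (Fin 2) ℂ}
    (ha : C.1 0 0 ≠ 0) {z : ℂ} (hz : ‖z‖ = 1) {v : Fin M × Fin 2 → ℂ}
    (h : z • (impurityBlock M C).mulVec v = v) : v = 0 := by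
  have hz0 : z ≠ 0 := by
    rintro rfl
    simp at hz
  have hEv : (impurityBlock M C).mulVec v = z⁻¹ • v := by
    conv_rhs => rw [← h]
    rw [inv_smul_smul₀ hz0]
  have hE : ∀ p, impurityWalk M C (embed v) (p.1 : ℤ) p.2 = z⁻¹ * v p := fun p => by
    rw [← impurityBlock_mulVec, hEv]
    rfl
  -- The norm is preserved and the part that stays is orthogonal to the part that leaves.
  have hexit : exitAmplitude M C 0 ⬝ᵥ v = 0 := by
    have hU := impurityWalk_embed M C v
    set y : StateSpace := (exitAmplitude M C 0 ⬝ᵥ v) • delta (-1) 0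
      + (exitAmplitude M C 1 ⬝ᵥ v) • delta M 1 with hy
    have horth : inner ℂ (embed (z⁻¹ • v)) y = 0 := by
      rw [hy, inner_add_right, inner_smul_right, inner_smul_right,
        ← inner_conj_symm (embed (z⁻¹ • v)) (delta _ _),
        ← inner_conj_symm (embed (z⁻¹ • v)) (delta _ _), inner_delta, inner_delta,
        embed_apply_of_not_mem _ (by omega), embed_apply_of_not_mem _ (by omega)]
      simp
    rw [hEv] at hU
    have hn := norm_add_sq_eq_norm_sq_add_norm_sq_of_inner_eq_zero _ _ horth
    rw [← hU, (impurityWalk M C).norm_map, embed_smul, norm_smul, norm_inv, hz] at hn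
    have hy0 : y = 0 := by
      rw [← norm_eq_zero]
      nlinarith
    have h1 : y (-1) 0 = (exitAmplitude M C 0 ⬝ᵥ v) * delta (-1) 0 (-1) 0
      + (exitAmplitude M C 1 ⬝ᵥ v) * delta M 1 (-1) 0 := rfl
    rw [hy0] at h1
    simpa [delta_apply] using h1.symm
  have hzero : ∀ n (hn : n < M), v (⟨n, hn⟩, 0) = 0 ∧ v (⟨n, hn⟩, 1) = 0 := by
    intro n
    induction n with
    | zero =>
      intro hn
      have hR : v (⟨0, hn⟩, 1) = 0 := by
        have := hE (⟨0, hn⟩, 1)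
        rw [impurityWalk_embed_one_eq_zero M C v (by simp)] at this
        exact (mul_eq_zero.1 this.symm).resolve_left (inv_ne_zero hz0)
      refine ⟨?_, hR⟩
      rw [exitAmplitude_dotProduct] at hexit
      change C.1 0 0 * v (⟨0, hn⟩, 0) + C.1 0 1 * v (⟨0, hn⟩, 1) = 0 at hexit
      rw [hR, mul_zero, add_zero] at hexit
      exact (mul_eq_zero.1 hexit).resolve_left ha
    | succ n ih =>
      intro hn
      obtain ⟨h0, h1⟩ := ih (by omega)
      have hR : v (⟨n + 1, hn⟩, 1) = 0 := by
        have := hE (⟨n + 1, hn⟩, 1)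
        rw [impurityWalk_apply_one M C _ ⟨n, by omega⟩ (by simp), embed_apply_site,
          embed_apply_site, h0, h1] at this
        simp only [mul_zero, add_zero] at this
        exact (mul_eq_zero.1 this.symm).resolve_left (inv_ne_zero hz0)
      refine ⟨?_, hR⟩
      have := hE (⟨n, by omega⟩, 0)
      rw [impurityWalk_apply_zero M C _ ⟨n + 1, hn⟩ (by simp), embed_apply_site,
        embed_apply_site, h0, hR] at this
      simp only [mul_zero, add_zero] at this
      exact (mul_eq_zero.1 this).resolve_left ha
  funext ⟨i, J⟩
  fin_cases J
  · exact (hzero i i.isLt).1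
  · exact (hzero i i.isLt).2

theorem isUnit_one_sub_smul_impurityBlock {M : ℕ} [NeZero M] {C : Matrix.unitaryGroup (Fin 2) ℂ}
    (ha : C.1 0 0 ≠ 0) {z : ℂ} (hz : ‖z‖ = 1) : IsUnit (1 - z • impurityBlock M C) := by
  rw [← Matrix.mulVec_injective_iff_isUnit]
  refine (injective_iff_map_eq_zero
    (Matrix.mulVecLin (1 - z • impurityBlock M C)).toAddMonoidHom).2 fun v hv => ?_
  change (1 - z • impurityBlock M C).mulVec v = 0 at hv
  rw [Matrix.sub_mulVec, Matrix.one_mulVec, Matrix.smul_mulVec, sub_eq_zero] at hv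
  exact eq_zero_of_smul_mulVec_eq ha hz hv.symm

theorem one_sub_sq_eq {R : Type*} [Ring R] (A : R) : 1 - A ^ 2 = (1 - A) * (1 + A) := by
  noncomm_ring

theorem isUnit_one_sub_smul_impurityBlock_sq {M : ℕ} [NeZero M]
    {C : Matrix.unitaryGroup (Fin 2) ℂ} (ha : C.1 0 0 ≠ 0) {z : ℂ} (hz : ‖z‖ = 1) :
    IsUnit (1 - (z • impurityBlock M C) ^ 2) := by
  rw [one_sub_sq_eq]
  refine (isUnit_one_sub_smul_impurityBlock ha hz).mul ?_
  have := isUnit_one_sub_smul_impurityBlock (M := M) ha (z := -z) (by rwa [norm_neg])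
  rwa [neg_smul, sub_neg_eq_add] at this

/-! ### The resolvent of `E_M` and the explicit coefficients -/

section Resolvent

variable {M : ℕ} [NeZero M] {C : Matrix.unitaryGroup (Fin 2) ℂ} {z : ℂ}

theorem resolvent_eq (ha : C.1 0 0 ≠ 0) (hz : ‖z‖ = 1) :
    (1 - z • impurityBlock M C)⁻¹
      = (1 + z • impurityBlock M C) * (1 - (z • impurityBlock M C) ^ 2)⁻¹ := by
  refine Matrix.inv_eq_right_inv ?_
  rw [← mul_assoc, ← one_sub_sq_eq]
  exact Matrix.mul_nonsing_inv _
    ((Matrix.isUnit_iff_isUnit_det _).1 (isUnit_one_sub_smul_impurityBlock_sq ha hz))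

/-- `(zE)^k (1 - (zE)²)⁻¹` connects sites at distances of the same parity as `k` only. -/
theorem smul_impurityBlock_pow_mul_green_apply_eq_zero (ha : C.1 0 0 ≠ 0) (hz : ‖z‖ = 1) (k : ℕ)
    {p q : Fin M × Fin 2} (h : Odd ((p.1 : ℕ) + q.1 + k)) :
    ((z • impurityBlock M C) ^ k * (1 - (z • impurityBlock M C) ^ 2)⁻¹ :
      Matrix (Fin M × Fin 2) (Fin M × Fin 2) ℂ) p q = 0 := by
  set A := z • impurityBlock M C with hA
  have hdet := (Matrix.isUnit_iff_isUnit_det _).1 (isUnit_one_sub_smul_impurityBlock_sq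
    (M := M) ha hz)
  rw [← hA] at hdet
  have h1 : parity M * A = -(A * parity M) := by
    rw [hA, Matrix.mul_smul, parity_mul_impurityBlock, Matrix.smul_mul, smul_neg]
  have h2 : ∀ n, parity M * A ^ n = (-1 : ℂ) ^ n • (A ^ n * parity M) := by
    intro n
    induction n with
    | zero => simp
    | succ n ih =>
      rw [pow_succ, ← mul_assoc, ih, Matrix.smul_mul, mul_assoc, h1, pow_succ (-1 : ℂ), mul_assoc]
      simp
  have h3 : parity M * (1 - A ^ 2) = (1 - A ^ 2) * parity M := by
    rw [mul_sub, sub_mul, h2]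
    simp
  have h4 : parity M * (1 - A ^ 2)⁻¹ = (1 - A ^ 2)⁻¹ * parity M := by
    calc parity M * (1 - A ^ 2)⁻¹
        = (1 - A ^ 2)⁻¹ * ((1 - A ^ 2) * parity M) * (1 - A ^ 2)⁻¹ := by
          rw [← mul_assoc, Matrix.nonsing_inv_mul _ hdet, one_mul]
      _ = (1 - A ^ 2)⁻¹ * parity M * ((1 - A ^ 2) * (1 - A ^ 2)⁻¹) := by
          rw [← h3]
          simp only [mul_assoc]
      _ = (1 - A ^ 2)⁻¹ * parity M := by rw [Matrix.mul_nonsing_inv _ hdet, mul_one]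
  have h5 : parity M * (A ^ k * (1 - A ^ 2)⁻¹)
      = (-1 : ℂ) ^ k • ((A ^ k * (1 - A ^ 2)⁻¹) * parity M) := by
    rw [← mul_assoc, h2, Matrix.smul_mul, mul_assoc, h4, mul_assoc]
  have h6 := congrFun (congrFun h5 p) q
  rw [Matrix.smul_apply, parity, Matrix.diagonal_mul, Matrix.mul_diagonal, smul_eq_mul] at h6
  have hsq : ((-1 : ℂ) ^ (p.1 : ℕ)) * (-1) ^ (p.1 : ℕ) = 1 := by
    rw [← mul_pow]; simp
  have h7 := h.neg_one_pow (α := ℂ)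
  rw [pow_add, pow_add] at h7
  set X := (A ^ k * (1 - A ^ 2)⁻¹ : Matrix (Fin M × Fin 2) (Fin M × Fin 2) ℂ) p q
  have : X = -X := by linear_combination (-X) * hsq + (-1 : ℂ) ^ (p.1 : ℕ) * h6 + X * h7
  exact self_eq_neg.1 this

/-- The resolvent entries between two states at the same site. -/
theorem resolvent_apply_of_same_site (ha : C.1 0 0 ≠ 0) (hz : ‖z‖ = 1) (i : Fin M)
    {J K : Fin 2} (h : J ≠ K) :
    (1 - z • impurityBlock M C)⁻¹ (i, J) (i, K)
      = ((z • impurityBlock M C) ^ 2 * (1 - (z • impurityBlock M C) ^ 2)⁻¹ :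
        Matrix (Fin M × Fin 2) (Fin M × Fin 2) ℂ) (i, J) (i, K) := by
  set A := z • impurityBlock M C with hA
  have hdet := (Matrix.isUnit_iff_isUnit_det _).1 (isUnit_one_sub_smul_impurityBlock_sq
    (M := M) ha hz)
  have h1 : (A ^ 1 * (1 - A ^ 2)⁻¹ : Matrix (Fin M × Fin 2) (Fin M × Fin 2) ℂ) (i, J) (i, K) = 0 :=
    smul_impurityBlock_pow_mul_green_apply_eq_zero ha hz 1 (by simp)
  have h2 : (1 - A ^ 2)⁻¹ = 1 + A ^ 2 * (1 - A ^ 2)⁻¹ := by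
    have := Matrix.mul_nonsing_inv _ hdet
    rw [← hA, sub_mul, one_mul, sub_eq_iff_eq_add] at this
    exact this
  rw [pow_one] at h1
  rw [resolvent_eq ha hz, ← hA, add_mul, one_mul, Matrix.add_apply, h1, add_zero]
  conv_lhs => rw [h2]
  rw [Matrix.add_apply, Matrix.one_apply_ne (by simpa using h), zero_add]

/-- The resolvent entries between two states at distance `n`: the first `n` terms of the Neumann
series vanish by finite propagation speed. -/
theorem resolvent_apply_of_dist (ha : C.1 0 0 ≠ 0) (hz : ‖z‖ = 1) {n : ℕ} {p q : Fin M × Fin 2}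
    (h : |(p.1 : ℤ) - q.1| = n) :
    (1 - z • impurityBlock M C)⁻¹ p q
      = z ^ n * (impurityBlock M C ^ n * (1 - (z • impurityBlock M C) ^ 2)⁻¹ :
        Matrix (Fin M × Fin 2) (Fin M × Fin 2) ℂ) p q := by
  have hparity : Even ((p.1 : ℕ) + q.1 + n) := by
    rcases abs_cases ((p.1 : ℤ) - q.1) with ⟨h1, -⟩ | ⟨h1, -⟩
    · exact ⟨p.1, by omega⟩
    · exact ⟨q.1, by omega⟩
  have hpow : z ^ n • (impurityBlock M C ^ n) = (z • impurityBlock M C) ^ n := by rw [smul_pow]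
  rw [← smul_eq_mul, ← Matrix.smul_apply, ← Matrix.smul_mul, hpow]
  have hdet := (Matrix.isUnit_iff_isUnit_det _).1 (isUnit_one_sub_smul_impurityBlock
    (M := M) ha hz)
  have hsum : (∑ k ∈ Finset.range n, (z • impurityBlock M C) ^ k) p q = 0 := by
    rw [Matrix.sum_apply]
    refine Finset.sum_eq_zero fun k hk => ?_
    have hk' := Finset.mem_range.1 hk
    rw [smul_pow, Matrix.smul_apply, impurityBlock_pow_apply_eq_zero M C k (by omega), smul_zero]
  have hodd := smul_impurityBlock_pow_mul_green_apply_eq_zero (C := C) ha hz (n + 1)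
    (p := p) (q := q) (by rw [← add_assoc]; exact hparity.add_one)
  have hres := resolvent_eq (M := M) ha hz
  set A := z • impurityBlock M C
  have hgeom : (1 - A)⁻¹ = (∑ k ∈ Finset.range n, A ^ k) + A ^ n * (1 - A)⁻¹ := by
    have h1 := geom_sum_mul_neg A n
    calc (1 - A)⁻¹ = (1 - A ^ n) * (1 - A)⁻¹ + A ^ n * (1 - A)⁻¹ := by
          rw [sub_mul, one_mul, sub_add_cancel]
      _ = _ := by rw [← h1, mul_assoc, Matrix.mul_nonsing_inv _ hdet, mul_one]
  rw [hgeom, Matrix.add_apply, hsum, zero_add, hres, ← mul_assoc, mul_add, mul_one, add_mul,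
    Matrix.add_apply, ← pow_succ, hodd, add_zero]

theorem resolvent_apply_of_row_eq_zero (ha : C.1 0 0 ≠ 0) (hz : ‖z‖ = 1) {p : Fin M × Fin 2}
    (hp : ∀ q, impurityBlock M C p q = 0) (q : Fin M × Fin 2) :
    (1 - z • impurityBlock M C)⁻¹ p q = (1 : Matrix (Fin M × Fin 2) (Fin M × Fin 2) ℂ) p q := by
  have hdet := (Matrix.isUnit_iff_isUnit_det _).1 (isUnit_one_sub_smul_impurityBlock
    (M := M) ha hz)
  have h := congrFun (congrFun (Matrix.mul_nonsing_inv _ hdet) p) q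
  rw [sub_mul, one_mul, Matrix.sub_apply, Matrix.smul_mul, Matrix.smul_apply,
    Matrix.mul_apply] at h
  simpa [hp] using h

end Resolvent

theorem norm_fourier_apply (n : ℤ) (ξ : Torus) : ‖(fourier n ξ : ℂ)‖ = 1 := by
  rw [fourier_apply]
  exact Circle.norm_coe _

theorem fourier_apply_neg (n : ℤ) (ξ : Torus) : (fourier n (-ξ) : ℂ) = fourier (-n) ξ := by
  simp [fourier_apply]

theorem fourier_pow (n : ℤ) (k : ℕ) (ξ : Torus) : (fourier n ξ : ℂ) ^ k = fourier (n * k) ξ := by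
  induction k with
  | zero => simp
  | succ k ih =>
    rw [pow_succ, ih, ← fourier_add]
    congr 2
    push_cast
    ring

section Coefficients

variable {M : ℕ} [NeZero M] {C : Matrix.unitaryGroup (Fin 2) ℂ}

theorem exitAmplitude_zero_vecMul (z : ℂ) (q : Fin M × Fin 2) :
    (Matrix.vecMul (exitAmplitude M C 0) (1 - z • impurityBlock M C)⁻¹) q
      = C.1 0 0 * (1 - z • impurityBlock M C)⁻¹ (firstSite M, 0) q
        + C.1 0 1 * (1 - z • impurityBlock M C)⁻¹ (firstSite M, 1) q :=
  exitAmplitude_dotProduct M C 0 _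

theorem exitAmplitude_one_vecMul (z : ℂ) (q : Fin M × Fin 2) :
    (Matrix.vecMul (exitAmplitude M C 1) (1 - z • impurityBlock M C)⁻¹) q
      = C.1 1 0 * (1 - z • impurityBlock M C)⁻¹ (lastSite M, 0) q
        + C.1 1 1 * (1 - z • impurityBlock M C)⁻¹ (lastSite M, 1) q :=
  exitAmplitude_dotProduct M C 1 _

theorem natCast_pred (M : ℕ) [NeZero M] : ((M - 1 : ℕ) : ℤ) = (M : ℤ) - 1 := by
  have := NeZero.pos M
  omega

/-- The amplitude of entering from the right and leaving to the left. -/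
theorem exitAmplitude_zero_vecMul_lastSite (ha : C.1 0 0 ≠ 0) (ξ : Torus) :
    (Matrix.vecMul (exitAmplitude M C 0)
        (1 - (fourier (-1) ξ : ℂ) • impurityBlock M C)⁻¹) (lastSite M, 0)
      = aHat M C ξ * fourier (-((M : ℤ) - 1)) ξ := by
  have hz := norm_fourier_apply (-1) ξ
  rw [exitAmplitude_zero_vecMul, resolvent_apply_of_row_eq_zero ha hz (impurityBlock_firstSite M C),
    Matrix.one_apply_ne (by simp), mul_zero, add_zero,
    resolvent_apply_of_dist (n := M - 1) ha hz, fourier_pow, natCast_pred]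
  · rw [aHat, impurityGreen, impurityDenominator, neg_one_mul]
    ring
  · rw [coe_firstSite, coe_lastSite, zero_sub, abs_neg, ← natCast_pred]
    simp

/-- The amplitude of entering from the left and leaving to the left. -/
theorem exitAmplitude_zero_vecMul_firstSite (ha : C.1 0 0 ≠ 0) (ξ : Torus) :
    (Matrix.vecMul (exitAmplitude M C 0)
        (1 - (fourier (-1) ξ : ℂ) • impurityBlock M C)⁻¹) (firstSite M, 1) = bHat M C ξ := by
  have hz := norm_fourier_apply (-1) ξ
  rw [exitAmplitude_zero_vecMul, resolvent_apply_of_row_eq_zero ha hz (impurityBlock_firstSite M C),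
    Matrix.one_apply_eq, resolvent_apply_of_same_site ha hz _ (by simp), bHat, impurityGreen,
    impurityDenominator]
  ring

/-- The amplitude of entering from the right and leaving to the right. -/
theorem exitAmplitude_one_vecMul_lastSite (ha : C.1 0 0 ≠ 0) (ξ : Torus) :
    (Matrix.vecMul (exitAmplitude M C 1)
        (1 - (fourier 1 ξ : ℂ) • impurityBlock M C)⁻¹) (lastSite M, 0)
      = cHat M C ξ * fourier (2 * ((M : ℤ) - 1)) ξ := by
  have hz := norm_fourier_apply 1 ξ
  have hexp : (fourier (-2 * ((M : ℤ) - 1)) ξ : ℂ) * fourier (2 * ((M : ℤ) - 1)) ξ = 1 := by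
    rw [← fourier_add, neg_mul, neg_add_cancel, fourier_zero]
  rw [exitAmplitude_one_vecMul, resolvent_apply_of_row_eq_zero ha hz (impurityBlock_lastSite M C),
    Matrix.one_apply_eq, resolvent_apply_of_same_site ha hz _ (by simp), cHat, impurityGreen,
    impurityDenominator, fourier_apply_neg, neg_neg, mul_assoc, hexp]
  ring

/-- The amplitude of entering from the left and leaving to the right. -/
theorem exitAmplitude_one_vecMul_firstSite (ha : C.1 0 0 ≠ 0) (ξ : Torus) :
    (Matrix.vecMul (exitAmplitude M C 1)
        (1 - (fourier 1 ξ : ℂ) • impurityBlock M C)⁻¹) (firstSite M, 1)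
      = dHat M C ξ * fourier ((M : ℤ) - 1) ξ := by
  have hz := norm_fourier_apply 1 ξ
  rw [exitAmplitude_one_vecMul, resolvent_apply_of_row_eq_zero ha hz (impurityBlock_lastSite M C),
    Matrix.one_apply_ne (by simp), mul_zero, zero_add,
    resolvent_apply_of_dist (n := M - 1) ha hz, fourier_pow, natCast_pred]
  · rw [dHat, impurityGreen, impurityDenominator, fourier_apply_neg, neg_neg, one_mul]
    ring
  · rw [coe_firstSite, coe_lastSite, sub_zero, ← natCast_pred]
    simp

end Coefficients

/-! ### Operators acting fibrewise in momentum space -/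

theorem Lp_coeFn_finset_sum {ι : Type*} (s : Finset ι) (f : ι → MomentumSpace) :
    ∀ᵐ ξ : Torus, (∑ i ∈ s, f i : MomentumSpace) ξ = ∑ i ∈ s, f i ξ := by
  classical
  induction s using Finset.induction_on with
  | empty => exact Lp.coeFn_zero Spinor 2 (volume : Measure Torus)
  | insert i s hi ih =>
    rw [Finset.sum_insert hi]
    filter_upwards [ih, Lp.coeFn_add (f i) (∑ j ∈ s, f j)] with ξ h1 h2
    rw [h2, Pi.add_apply, h1, Finset.sum_insert hi]

theorem ae_neg {p : Torus → Prop} (h : ∀ᵐ ξ, p ξ) : ∀ᵐ ξ : Torus, p (-ξ) :=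
  (Measure.measurePreserving_neg (volume : Measure Torus)).quasiMeasurePreserving.ae h

theorem continuous_act (A : Matrix (Fin 2) (Fin 2) ℂ) : Continuous (act A) :=
  LinearMap.continuous_of_finiteDimensional _

/-- The states on which the operator `B` acts, after Fourier transform, as
`ψ ↦ P(ξ) ψ(ξ) + Q(ξ) ψ(-ξ)`. -/
def fibrewiseSubspace (B : StateSpace →L[ℂ] MomentumSpace)
    (P Q : Torus → Matrix (Fin 2) (Fin 2) ℂ) : Submodule ℂ StateSpace where
  carrier := {ψ | ∀ᵐ ξ : Torus, B ψ ξ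
    = act (P ξ) (fourierTransform ψ ξ) + act (Q ξ) (fourierTransform ψ (-ξ))}
  add_mem' := by
    intro ψ φ hψ hφ
    simp only [Set.mem_ofPred_eq, map_add] at hψ hφ ⊢
    have h := Lp.coeFn_add (fourierTransform ψ) (fourierTransform φ)
    filter_upwards [hψ, hφ, Lp.coeFn_add (B ψ) (B φ), h, ae_neg h] with ξ h1 h2 h3 h4 h5
    rw [h3, h4, h5]
    simp only [Pi.add_apply]
    rw [h1, h2, map_add, map_add]
    abel
  zero_mem' := by
    simp only [Set.mem_ofPred_eq, map_zero]
    have h := Lp.coeFn_zero Spinor 2 (volume : Measure Torus)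
    filter_upwards [h, ae_neg h] with ξ h1 h2
    rw [h1, h2]
    simp
  smul_mem' := by
    intro z ψ hψ
    simp only [Set.mem_ofPred_eq, map_smul] at hψ ⊢
    have h := Lp.coeFn_smul z (fourierTransform ψ)
    filter_upwards [hψ, Lp.coeFn_smul z (B ψ), h, ae_neg h] with ξ h1 h2 h3 h4
    rw [h2, h3, h4]
    simp only [Pi.smul_apply]
    rw [h1, map_smul, map_smul, smul_add]

theorem mem_fibrewiseSubspace {B : StateSpace →L[ℂ] MomentumSpace}
    {P Q : Torus → Matrix (Fin 2) (Fin 2) ℂ} {ψ : StateSpace} :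
    ψ ∈ fibrewiseSubspace B P Q ↔ ∀ᵐ ξ : Torus, B ψ ξ
      = act (P ξ) (fourierTransform ψ ξ) + act (Q ξ) (fourierTransform ψ (-ξ)) := Iff.rfl

/-- A convergent sequence in `L²` has a subsequence converging almost everywhere, so that a
fibrewise identity passes to limits, whatever the coefficients `P` and `Q`. -/
theorem isClosed_fibrewiseSubspace (B : StateSpace →L[ℂ] MomentumSpace)
    (P Q : Torus → Matrix (Fin 2) (Fin 2) ℂ) :
    IsClosed (fibrewiseSubspace B P Q : Set StateSpace) := by
  refine isClosed_of_closure_subset fun ψ hψ => ?_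
  obtain ⟨u, hu, hlim⟩ := mem_closure_iff_seq_limit.1 hψ
  have hB := tendstoInMeasure_of_tendsto_Lp ((B.continuous.tendsto ψ).comp hlim)
  obtain ⟨m, hm, hBm⟩ := hB.exists_seq_tendsto_ae
  have hF := tendstoInMeasure_of_tendsto_Lp
    (((fourierTransform.continuous.tendsto ψ).comp hlim).comp hm.tendsto_atTop)
  obtain ⟨n, hn, hFn⟩ := hF.exists_seq_tendsto_ae
  have hmem : ∀ᵐ ξ : Torus, ∀ k, B (u k) ξ
    = act (P ξ) (fourierTransform (u k) ξ) + act (Q ξ) (fourierTransform (u k) (-ξ)) :=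
    ae_all_iff.2 hu
  change ∀ᵐ ξ : Torus, _
  filter_upwards [hBm, hFn, ae_neg hFn, hmem] with ξ h1 h2 h3 h4
  refine tendsto_nhds_unique (h1.comp hn.tendsto_atTop) ?_
  refine ((((continuous_act (P ξ)).tendsto _).comp h2).add
    (((continuous_act (Q ξ)).tendsto _).comp h3)).congr fun k => ?_
  exact (h4 _).symm

theorem fourierTransform_delta (x : ℤ) (J : Fin 2) :
    fourierTransform (delta x J) = modeIsometry x (ket J) :=
  isHilbertSum_mode.linearIsometryEquiv_symm_apply_single (ket J)

/-- The normalisation `(2π)^{-1/2}` of the Fourier transform. -/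
noncomputable def fourierConst : ℂ := (((Real.sqrt (2 * Real.pi))⁻¹ : ℝ) : ℂ)

theorem fourierConst_ne_zero : fourierConst ≠ 0 := by
  unfold fourierConst
  exact_mod_cast inv_ne_zero (Real.sqrt_ne_zero'.2 Real.two_pi_pos)

theorem modeIsometry_ae (x : ℤ) (v : Spinor) :
    ∀ᵐ ξ : Torus, modeIsometry x v ξ = (fourierConst * fourier (-x) ξ) • v := by
  filter_upwards [ContinuousMap.coeFn_toLp (p := 2) (𝕜 := ℂ) (volume : Measure Torus)
    (mode x v)] with ξ h
  refine h.trans ?_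
  rw [mul_smul]
  rfl

theorem fourierTransform_delta_ae (x : ℤ) (J : Fin 2) :
    ∀ᵐ ξ : Torus, ∀ K, fourierTransform (delta x J) ξ K
      = if K = J then fourierConst * fourier (-x) ξ else 0 := by
  rw [fourierTransform_delta]
  filter_upwards [modeIsometry_ae x (ket J)] with ξ h K
  rw [h]
  simp [ket]

/-- The free walk is multiplication by its symbol `diag(e^{iξ}, e^{-iξ})`. -/
theorem fourierTransform_freeWalk (ψ : StateSpace) :
    ∀ᵐ ξ : Torus, fourierTransform (freeWalk ψ) ξ 0 = fourier 1 ξ * fourierTransform ψ ξ 0 ∧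
      fourierTransform (freeWalk ψ) ξ 1 = fourier (-1) ξ * fourierTransform ψ ξ 1 := by
  let B : StateSpace →L[ℂ] MomentumSpace :=
    (fourierTransform : StateSpace →L[ℂ] MomentumSpace) ∘L (freeWalk : StateSpace →L[ℂ] StateSpace)
  have htop : fibrewiseSubspace B freeSymbol 0 = ⊤ := by
    refine eq_top_of_delta_mem (isClosed_fibrewiseSubspace _ _ _) fun x J => ?_
    change ∀ᵐ ξ : Torus, fourierTransform (freeWalk (delta x J)) ξ = _
    rw [freeWalk_delta]
    filter_upwards [fourierTransform_delta_ae x J,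
      fourierTransform_delta_ae (x + velocity J) J] with ξ h1 h2
    ext K
    rw [h2, PiLp.add_apply, act_apply, act_apply, h1, h1, neg_add, fourier_add]
    fin_cases J <;> fin_cases K <;> simp [freeSymbol, velocity] <;> ring
  have h : ψ ∈ fibrewiseSubspace B freeSymbol 0 := htop ▸ Submodule.mem_top
  filter_upwards [mem_fibrewiseSubspace.1 h] with ξ hξ
  change fourierTransform (freeWalk ψ) ξ = _ at hξ
  rw [hξ, PiLp.add_apply, PiLp.add_apply]
  simp [act_apply, freeSymbol]

/-! ### The scattering operator in momentum space -/

section Scattering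

variable {M : ℕ} [NeZero M] {C : Matrix.unitaryGroup (Fin 2) ℂ}
  {Wp Wm : StateSpace →L[ℂ] StateSpace}

theorem fourier_mul_fourier_neg (n : ℤ) (ξ : Torus) :
    (fourier n ξ : ℂ) * fourier (-n) ξ = 1 := by
  rw [← fourier_add, add_neg_cancel, fourier_zero]

/-- One step of the walk decomposes the states on the impurities; its image under `W₊*` is a
linear system for `W₊* δ_p`, `p` running over the impurities. -/
theorem freeWalk_adjoint_delta (hp : IsWaveOperator (impurityWalk M C) freeWalk atTop Wp)
    (p : Fin M × Fin 2) :
    freeWalk (ContinuousLinearMap.adjoint Wp (delta p.1 p.2))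
      = ∑ q, impurityBlock M C q p • ContinuousLinearMap.adjoint Wp (delta q.1 q.2)
        + (exitAmplitude M C 0 p • delta (-1) 0 + exitAmplitude M C 1 p • delta M 1) := by
  have hL : Wp (delta (-1) 0) = delta (-1) 0 := hp.map_delta_atTop fun t ht => by
    simp only [velocity, if_true]
    omega
  have hR : Wp (delta M 1) = delta M 1 := hp.map_delta_atTop fun t ht => by
    simp only [velocity, one_ne_zero, if_false]
    omega
  have hL' := hp.adjoint_apply_self (delta (-1) 0)
  have hR' := hp.adjoint_apply_self (delta M 1)
  rw [hL] at hL'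
  rw [hR] at hR'
  rw [← hp.adjoint_map tendsto_add_one_atTop_int, ← embed_single, impurityWalk_embed, map_add,
    map_add, map_smul, map_smul, hL', hR', embed, map_sum]
  simp only [map_smul, Matrix.mulVec_single_one, dotProduct_single_one]
  rfl

theorem eq_vecMul_inv {n : Type*} [Fintype n] [DecidableEq n] {A : Matrix n n ℂ}
    (hA : IsUnit A) {u v : n → ℂ} (h : Matrix.vecMul u A = v) : u = Matrix.vecMul v A⁻¹ := by
  rw [← h, Matrix.vecMul_vecMul, Matrix.mul_nonsing_inv _ ((Matrix.isUnit_iff_isUnit_det _).1 hA),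
    Matrix.vecMul_one]

/-- The solution of the linear system by the resolvent of `E_M`. -/
theorem fourierTransform_adjoint_delta (ha : C.1 0 0 ≠ 0)
    (hp : IsWaveOperator (impurityWalk M C) freeWalk atTop Wp) :
    ∀ᵐ ξ : Torus, ∀ p : Fin M × Fin 2,
      fourierTransform (ContinuousLinearMap.adjoint Wp (delta p.1 p.2)) ξ 0
        = fourierConst * (Matrix.vecMul (exitAmplitude M C 0)
            (1 - (fourier (-1) ξ : ℂ) • impurityBlock M C)⁻¹) p ∧
      fourierTransform (ContinuousLinearMap.adjoint Wp (delta p.1 p.2)) ξ 1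
        = fourierConst * fourier (-((M : ℤ) - 1)) ξ * (Matrix.vecMul (exitAmplitude M C 1)
            (1 - (fourier 1 ξ : ℂ) • impurityBlock M C)⁻¹) p := by
  set n : Fin M × Fin 2 → StateSpace :=
    fun p => ContinuousLinearMap.adjoint Wp (delta p.1 p.2) with hn
  have hsys : ∀ᵐ ξ : Torus, ∀ p K, fourierTransform (freeWalk (n p)) ξ K
      = ∑ q, impurityBlock M C q p * fourierTransform (n q) ξ K
        + (exitAmplitude M C 0 p * fourierTransform (delta (-1) 0) ξ K
          + exitAmplitude M C 1 p * fourierTransform (delta M 1) ξ K) := by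
    refine ae_all_iff.2 fun p => ?_
    rw [hn]
    simp only [freeWalk_adjoint_delta hp p, map_add, map_sum, map_smul]
    have hsmul : ∀ᵐ ξ : Torus, ∀ q, (impurityBlock M C q p • fourierTransform (n q)) ξ
        = impurityBlock M C q p • fourierTransform (n q) ξ :=
      ae_all_iff.2 fun q => Lp.coeFn_smul _ _
    filter_upwards [hsmul, Lp_coeFn_finset_sum Finset.univ
        fun q => impurityBlock M C q p • fourierTransform (n q),
      Lp.coeFn_add (∑ q, impurityBlock M C q p • fourierTransform (n q))
        (exitAmplitude M C 0 p • fourierTransform (delta (-1) 0)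
          + exitAmplitude M C 1 p • fourierTransform (delta M 1)),
      Lp.coeFn_add (exitAmplitude M C 0 p • fourierTransform (delta (-1) 0))
        (exitAmplitude M C 1 p • fourierTransform (delta M 1)),
      Lp.coeFn_smul (exitAmplitude M C 0 p) (fourierTransform (delta (-1) 0)),
      Lp.coeFn_smul (exitAmplitude M C 1 p) (fourierTransform (delta M 1))]
      with ξ h1 h2 h3 h4 h5 h6 K
    rw [h3, Pi.add_apply, h2, h4, Pi.add_apply, h5, h6]
    simp only [h1]
    simp [hn]
  filter_upwards [hsys, ae_all_iff.2 fun p => fourierTransform_freeWalk (n p),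
    fourierTransform_delta_ae (-1) 0, fourierTransform_delta_ae M 1] with ξ h1 h2 h3 h4
  have inv1 : (fourier (-1) ξ : ℂ) * fourier 1 ξ = 1 := fourier_mul_fourier_neg (-1) ξ
  have hM : (fourier 1 ξ : ℂ) * fourier (-(M : ℤ)) ξ = fourier (-((M : ℤ) - 1)) ξ := by
    rw [← fourier_add]
    congr 2
    ring
  have e0 : (fun p => fourierTransform (n p) ξ 0) = Matrix.vecMul
      (fourierConst • exitAmplitude M C 0) (1 - (fourier (-1) ξ : ℂ) • impurityBlock M C)⁻¹ := by
    refine eq_vecMul_inv (isUnit_one_sub_smul_impurityBlock ha (norm_fourier_apply _ _)) ?_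
    funext p
    rw [Matrix.vecMul_sub, Matrix.vecMul_one, Matrix.vecMul_smul, Pi.sub_apply, Pi.smul_apply,
      Pi.smul_apply, smul_eq_mul, smul_eq_mul]
    have h := h1 p 0
    rw [(h2 p).1, h3, h4, if_pos rfl, if_neg (by simp), neg_neg] at h
    have hs : Matrix.vecMul (fun p => fourierTransform (n p) ξ 0) (impurityBlock M C) p
        = ∑ q, impurityBlock M C q p * fourierTransform (n q) ξ 0 :=
      Finset.sum_congr rfl fun q _ => mul_comm _ _
    rw [hs]
    linear_combination (fourier (-1) ξ : ℂ) * h + (fourierConst * exitAmplitude M C 0 p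
      - fourierTransform (n p) ξ 0) * inv1
  have e1 : (fun p => fourierTransform (n p) ξ 1) = Matrix.vecMul
      ((fourierConst * fourier (-((M : ℤ) - 1)) ξ) • exitAmplitude M C 1)
      (1 - (fourier 1 ξ : ℂ) • impurityBlock M C)⁻¹ := by
    refine eq_vecMul_inv (isUnit_one_sub_smul_impurityBlock ha (norm_fourier_apply _ _)) ?_
    funext p
    rw [Matrix.vecMul_sub, Matrix.vecMul_one, Matrix.vecMul_smul, Pi.sub_apply, Pi.smul_apply,
      Pi.smul_apply, smul_eq_mul, smul_eq_mul]
    have h := h1 p 1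
    rw [(h2 p).2, h3, h4, if_pos rfl, if_neg (by simp)] at h
    have hs : Matrix.vecMul (fun p => fourierTransform (n p) ξ 1) (impurityBlock M C) p
        = ∑ q, impurityBlock M C q p * fourierTransform (n q) ξ 1 :=
      Finset.sum_congr rfl fun q _ => mul_comm _ _
    rw [hs]
    linear_combination (fourier 1 ξ : ℂ) * h - fourierTransform (n p) ξ 1 * inv1
      + fourierConst * exitAmplitude M C 1 p * hM
  intro p
  have h0 := congrFun e0 p
  have h1' := congrFun e1 p
  rw [Matrix.smul_vecMul, Pi.smul_apply, smul_eq_mul] at h0 h1'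
  exact ⟨h0, h1'⟩

/-- The states on which the explicit formula for the scattering operator holds. -/
noncomputable def scatteringSubspace (M : ℕ) [NeZero M] (C : Matrix.unitaryGroup (Fin 2) ℂ)
    (Wp Wm : StateSpace →L[ℂ] StateSpace) : Submodule ℂ StateSpace :=
  fibrewiseSubspace ((fourierTransform : StateSpace →L[ℂ] MomentumSpace) ∘L
    scatteringOperator Wp Wm) (transmissionMatrix M C) (reflectionMatrix M C)

theorem mem_scatteringSubspace {ψ : StateSpace} :
    ψ ∈ scatteringSubspace M C Wp Wm ↔ ∀ᵐ ξ : Torus,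
      fourierTransform (scatteringOperator Wp Wm ψ) ξ 0
          = aHat M C ξ * fourierTransform ψ ξ 0 + bHat M C ξ * fourierTransform ψ (-ξ) 1 ∧
      fourierTransform (scatteringOperator Wp Wm ψ) ξ 1
          = dHat M C ξ * fourierTransform ψ ξ 1 + cHat M C ξ * fourierTransform ψ (-ξ) 0 := by
  refine mem_fibrewiseSubspace.trans (eventually_congr (Eventually.of_forall fun ξ => ?_))
  change fourierTransform (scatteringOperator Wp Wm ψ) ξ = _ ↔ _
  rw [PiLp.ext_iff, Fin.forall_fin_two, PiLp.add_apply, PiLp.add_apply]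
  simp [act_apply, transmissionMatrix, reflectionMatrix]

/-- The formula for a particle that comes in from the right: `δ_{M-1}|L⟩` is fixed by `W₋`. -/
theorem delta_lastSite_mem (ha : C.1 0 0 ≠ 0)
    (hp : IsWaveOperator (impurityWalk M C) freeWalk atTop Wp)
    (hm : IsWaveOperator (impurityWalk M C) freeWalk atBot Wm) :
    delta ((M : ℤ) - 1) 0 ∈ scatteringSubspace M C Wp Wm := by
  have hfix : Wm (delta ((M : ℤ) - 1) 0) = delta ((M : ℤ) - 1) 0 :=
    hm.map_delta_atBot fun t ht => by
      simp only [velocity, if_true]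
      omega
  rw [mem_scatteringSubspace]
  simp only [scatteringOperator, ContinuousLinearMap.comp_apply, hfix]
  have h := fourierTransform_delta_ae ((M : ℤ) - 1) 0
  filter_upwards [fourierTransform_adjoint_delta ha hp, h, ae_neg h] with ξ h1 h2 h3
  have h4 := h1 (lastSite M, 0)
  rw [coe_lastSite, exitAmplitude_zero_vecMul_lastSite ha, exitAmplitude_one_vecMul_lastSite ha]
    at h4
  have hexp : (fourier (-((M : ℤ) - 1)) ξ : ℂ) * fourier (2 * ((M : ℤ) - 1)) ξ
      = fourier ((M : ℤ) - 1) ξ := by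
    rw [← fourier_add]
    congr 2
    ring
  simp only [h2, h3, if_true, one_ne_zero, if_false, mul_zero, add_zero, zero_add,
    fourier_apply_neg, neg_neg]
  refine ⟨h4.1.trans (by ring), h4.2.trans ?_⟩
  linear_combination fourierConst * cHat M C ξ * hexp

/-- The formula for a particle that comes in from the left: `δ_0|R⟩` is fixed by `W₋`. -/
theorem delta_firstSite_mem (ha : C.1 0 0 ≠ 0)
    (hp : IsWaveOperator (impurityWalk M C) freeWalk atTop Wp)
    (hm : IsWaveOperator (impurityWalk M C) freeWalk atBot Wm) :
    delta 0 1 ∈ scatteringSubspace M C Wp Wm := by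
  have hfix : Wm (delta 0 1) = delta 0 1 :=
    hm.map_delta_atBot fun t ht => by
      simp only [velocity, one_ne_zero, if_false]
      omega
  rw [mem_scatteringSubspace]
  simp only [scatteringOperator, ContinuousLinearMap.comp_apply, hfix]
  have h := fourierTransform_delta_ae 0 1
  filter_upwards [fourierTransform_adjoint_delta ha hp, h, ae_neg h] with ξ h1 h2 h3
  have h4 := h1 (firstSite M, 1)
  rw [coe_firstSite, exitAmplitude_zero_vecMul_firstSite ha,
    exitAmplitude_one_vecMul_firstSite ha] at h4
  have hexp := fourier_mul_fourier_neg ((M : ℤ) - 1) ξ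
  simp only [h2, h3, if_true, zero_ne_one, if_false, mul_zero, add_zero, zero_add, neg_zero,
    fourier_zero]
  refine ⟨h4.1.trans (by ring), h4.2.trans ?_⟩
  linear_combination fourierConst * dHat M C ξ * hexp

/-- Both sides of the formula commute with the free walk, which multiplies the components of each
side by the same phases. -/
theorem freeWalk_mem_iff (hp : IsWaveOperator (impurityWalk M C) freeWalk atTop Wp)
    (hm : IsWaveOperator (impurityWalk M C) freeWalk atBot Wm) (ψ : StateSpace) :
    freeWalk ψ ∈ scatteringSubspace M C Wp Wm ↔ ψ ∈ scatteringSubspace M C Wp Wm := by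
  rw [mem_scatteringSubspace, mem_scatteringSubspace, scatteringOperator_freeWalk hp hm]
  have h := fourierTransform_freeWalk ψ
  refine eventually_congr ?_
  filter_upwards [h, ae_neg h, fourierTransform_freeWalk (scatteringOperator Wp Wm ψ)]
    with ξ h1 h2 h3
  rw [h1.1, h1.2, h2.1, h2.2, h3.1, h3.2, fourier_apply_neg, fourier_apply_neg, neg_neg,
    mul_left_comm (aHat M C ξ), mul_left_comm (bHat M C ξ), mul_left_comm (cHat M C ξ),
    mul_left_comm (dHat M C ξ), ← mul_add, ← mul_add]
  have hne : ∀ n : ℤ, (fourier n ξ : ℂ) ≠ 0 := fun n h0 => by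
    have := norm_fourier_apply n ξ
    simp [h0] at this
  rw [mul_right_inj' (hne _), mul_right_inj' (hne _)]

theorem delta_add_mem_iff (hp : IsWaveOperator (impurityWalk M C) freeWalk atTop Wp)
    (hm : IsWaveOperator (impurityWalk M C) freeWalk atBot Wm) (x t : ℤ) (J : Fin 2) :
    delta (x + t) J ∈ scatteringSubspace M C Wp Wm
      ↔ delta x J ∈ scatteringSubspace M C Wp Wm := by
  have shift : ∀ y, delta (y + velocity J) J ∈ scatteringSubspace M C Wp Wm
      ↔ delta y J ∈ scatteringSubspace M C Wp Wm := fun y => by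
    rw [← freeWalk_delta, freeWalk_mem_iff hp hm]
  have succ : ∀ y, delta (y + 1) J ∈ scatteringSubspace M C Wp Wm
      ↔ delta y J ∈ scatteringSubspace M C Wp Wm := fun y => by
    rcases velocity_eq J with h | h
    · have := shift (y + 1)
      rw [h, add_neg_cancel_right] at this
      exact this.symm
    · rw [← shift y, h]
  induction t using Int.induction_on with
  | zero => rw [add_zero]
  | succ n ih => rw [← add_assoc]; exact (succ _).trans ih
  | pred n ih =>
    rw [← add_sub_assoc]
    refine (succ _).symm.trans ?_
    rwa [sub_add_cancel]

theorem scatteringSubspace_eq_top (ha : C.1 0 0 ≠ 0)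
    (hp : IsWaveOperator (impurityWalk M C) freeWalk atTop Wp)
    (hm : IsWaveOperator (impurityWalk M C) freeWalk atBot Wm) :
    scatteringSubspace M C Wp Wm = ⊤ := by
  refine eq_top_of_delta_mem (isClosed_fibrewiseSubspace _ _ _) fun x J => ?_
  have key : ∃ y, delta y J ∈ scatteringSubspace M C Wp Wm := by
    fin_cases J
    · exact ⟨_, delta_lastSite_mem ha hp hm⟩
    · exact ⟨_, delta_firstSite_mem ha hp hm⟩
  obtain ⟨y, hy⟩ := key
  rw [← add_sub_cancel y x]
  exact (delta_add_mem_iff hp hm _ _ _).2 hy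

theorem momentumConj_scatteringOperator_apply (ha : C.1 0 0 ≠ 0)
    (hp : IsWaveOperator (impurityWalk M C) freeWalk atTop Wp)
    (hm : IsWaveOperator (impurityWalk M C) freeWalk atBot Wm) (f : MomentumSpace) :
    ∀ᵐ ξ : Torus, momentumConj (scatteringOperator Wp Wm) f ξ
      = act (transmissionMatrix M C ξ) (f ξ) + act (reflectionMatrix M C ξ) (f (-ξ)) := by
  obtain ⟨ψ, rfl⟩ := fourierTransform.surjective f
  have h : ψ ∈ scatteringSubspace M C Wp Wm :=
    scatteringSubspace_eq_top ha hp hm ▸ Submodule.mem_top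
  have e : momentumConj (scatteringOperator Wp Wm) (fourierTransform ψ)
      = fourierTransform (scatteringOperator Wp Wm ψ) := by
    simp [momentumConj]
  rw [e]
  exact h

end Scattering

/-! ### The energy fibres -/

theorem eq_or_eq_neg_of_mem_momentumSet {θ : ℝ} {ξ : Torus} (h : ξ ∈ momentumSet θ) :
    ξ = (θ : Torus) ∨ ξ = -(θ : Torus) := by
  have inj : ∀ η : Torus, (fourier 1 η : ℂ) = Complex.exp (θ * Complex.I) → η = (θ : Torus) := by
    intro η hη
    have e : (fourier 1 (θ : Torus) : ℂ) = Complex.exp (θ * Complex.I) := by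
      rw [fourier_coe_eq]
      simp
    rw [← e, fourier_one, fourier_one] at hη
    exact AddCircle.injective_toCircle Real.two_pi_pos.ne' (Circle.coe_injective hη)
  rw [mem_momentumSet_iff] at h
  rcases mul_eq_zero.1 h with h | h
  · exact Or.inl (inj ξ (sub_eq_zero.1 h))
  · right
    rw [← inj (-ξ) (by rw [fourier_apply_neg]; exact sub_eq_zero.1 h), neg_neg]

/-- A property of almost every momentum holds on almost every energy fibre. -/
theorem ae_forall_mem_momentumSet {p : Torus → Prop} (h : ∀ᵐ ξ, p ξ) :
    ∀ᵐ θ ∂(volume.restrict (Set.Icc (0 : ℝ) (2 * Real.pi))), ∀ ξ ∈ momentumSet θ, p ξ := by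
  have pull : ∀ {q : Torus → Prop}, (∀ᵐ ξ, q ξ) →
      ∀ᵐ θ : ℝ ∂(volume.restrict (Set.Icc (0 : ℝ) (2 * Real.pi))), q (θ : Torus) := by
    intro q hq
    have := (AddCircle.measurePreserving_mk (2 * Real.pi) 0).quasiMeasurePreserving.ae hq
    rw [zero_add] at this
    rwa [Measure.restrict_congr_set Ioc_ae_eq_Icc] at this
  filter_upwards [pull h, pull (ae_neg h)] with θ h1 h2 ξ hξ
  rcases eq_or_eq_neg_of_mem_momentumSet hξ with rfl | rfl
  · exact h1
  · exact h2

/-- The operator `ψ ↦ P(ξ) ψ(ξ) + Q(ξ) ψ(-ξ)` on the fibre `h(θ)`. -/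
noncomputable def fibreOperator (P Q : Torus → Matrix (Fin 2) (Fin 2) ℂ) (θ : ℝ) :
    Fibre θ →ₗ[ℂ] Fibre θ where
  toFun ψ ξ := act (P ξ.1) (ψ ξ) + act (Q ξ.1) (ψ (negPoint ξ))
  map_add' ψ φ := by
    funext ξ
    simp only [Pi.add_apply, map_add]
    abel
  map_smul' z ψ := by
    funext ξ
    simp

theorem fibreOperator_apply (P Q : Torus → Matrix (Fin 2) (Fin 2) ℂ) (θ : ℝ) (ψ : Fibre θ)
    (ξ : momentumSet θ) :
    fibreOperator P Q θ ψ ξ = act (P ξ.1) (ψ ξ) + act (Q ξ.1) (ψ (negPoint ξ)) := rfl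

theorem isFibreFamily_fibreOperator {A : MomentumSpace →L[ℂ] MomentumSpace}
    {P Q : Torus → Matrix (Fin 2) (Fin 2) ℂ}
    (h : ∀ f : MomentumSpace, ∀ᵐ ξ : Torus, A f ξ = act (P ξ) (f ξ) + act (Q ξ) (f (-ξ))) :
    IsFibreFamily A (fibreOperator P Q) := by
  intro f
  filter_upwards [ae_forall_mem_momentumSet (h f)] with θ hθ
  funext ξ
  exact hθ ξ.1 ξ.2

/-- A function on a fibre, which has at most the two points `±θ`, is a combination of the functions
`v` and `e^{iξ} v`, `v ∈ {|L⟩, |R⟩}`: the function `e^{iξ}` separates the points. -/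
theorem exists_interpolation (θ : ℝ) (ψ : Fibre θ) :
    ∃ v w : Spinor, ∀ ξ : momentumSet θ, ψ ξ = v + (fourier 1 ξ.1 : ℂ) • w := by
  have hmem : (θ : Torus) ∈ momentumSet θ := by
    rw [mem_momentumSet_iff, fourier_coe_eq]
    simp
  set η : momentumSet θ := ⟨(θ : Torus), hmem⟩ with hη
  have hcases : ∀ ξ : momentumSet θ, ξ = η ∨ ξ = negPoint η := fun ξ =>
    (eq_or_eq_neg_of_mem_momentumSet ξ.2).imp Subtype.ext Subtype.ext
  by_cases h : negPoint η = η
  · refine ⟨ψ η, 0, fun ξ => ?_⟩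
    rcases hcases ξ with rfl | rfl
    · simp
    · rw [h]
      simp
  · have hne : (fourier 1 η.1 : ℂ) - fourier 1 (negPoint η).1 ≠ 0 := by
      rw [sub_ne_zero, fourier_one, fourier_one]
      intro e
      exact h (Subtype.ext
        (AddCircle.injective_toCircle Real.two_pi_pos.ne' (Circle.coe_injective e)).symm)
    set d := (fourier 1 η.1 : ℂ) - fourier 1 (negPoint η).1 with hd
    refine ⟨ψ η - (fourier 1 η.1 : ℂ) • d⁻¹ • (ψ η - ψ (negPoint η)),
      d⁻¹ • (ψ η - ψ (negPoint η)), fun ξ => ?_⟩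
    rcases hcases ξ with e | e
    · rw [e, sub_add_cancel]
    · rw [e]
      have e2 : (fourier 1 (negPoint η).1 : ℂ) = fourier 1 η.1 - d := by rw [hd]; ring
      rw [e2, sub_smul, smul_inv_smul₀ hne]
      abel

/-- The fibre operators are determined almost everywhere, because the restrictions of the modes
`v` and `e^{iξ} v` span every fibre. -/
theorem IsFibreFamily.ae_eq {A : MomentumSpace →L[ℂ] MomentumSpace}
    {S S' : (θ : ℝ) → Fibre θ →ₗ[ℂ] Fibre θ} (hS : IsFibreFamily A S)
    (hS' : IsFibreFamily A S') :
    ∀ᵐ θ ∂(volume.restrict (Set.Icc (0 : ℝ) (2 * Real.pi))), S' θ = S θ := by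
  have hall : ∀ᵐ θ ∂(volume.restrict (Set.Icc (0 : ℝ) (2 * Real.pi))), ∀ (s : Bool) (J : Fin 2),
      S' θ (fun ξ => (fourier (if s then 1 else 0) ξ.1 : ℂ) • ket J)
        = S θ (fun ξ => (fourier (if s then 1 else 0) ξ.1 : ℂ) • ket J) := by
    refine ae_all_iff.2 fun s => ae_all_iff.2 fun J => ?_
    set n : ℤ := if s then 1 else 0
    filter_upwards [hS (modeIsometry (-n) (ket J)), hS' (modeIsometry (-n) (ket J)),
      ae_forall_mem_momentumSet (modeIsometry_ae (-n) (ket J))] with θ h1 h2 h3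
    have e : fibreRestrict θ (modeIsometry (-n) (ket J))
        = fourierConst • (fun ξ : momentumSet θ => (fourier n ξ.1 : ℂ) • ket J) := by
      funext ξ
      rw [Pi.smul_apply, ← mul_smul]
      refine (h3 ξ.1 ξ.2).trans ?_
      rw [neg_neg]
    rw [e, map_smul] at h1 h2
    exact smul_right_injective _ fourierConst_ne_zero (h2.symm.trans h1)
  filter_upwards [hall] with θ h
  refine LinearMap.ext fun ψ => ?_
  obtain ⟨v, w, hvw⟩ := exists_interpolation θ ψ
  have e : ψ = ∑ J : Fin 2, (v J • (fun ξ : momentumSet θ =>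
        (fourier (if false then 1 else 0) ξ.1 : ℂ) • ket J)
      + w J • (fun ξ : momentumSet θ => (fourier (if true then 1 else 0) ξ.1 : ℂ) • ket J)) := by
    funext ξ
    rw [hvw ξ]
    ext K
    fin_cases K <;> simp [Fin.sum_univ_two, ket, mul_comm]
  rw [e, map_sum, map_sum]
  refine Finset.sum_congr rfl fun J _ => ?_
  have hf := h false J
  have ht := h true J
  simp only [Bool.false_eq_true, if_false, if_true] at hf ht ⊢
  rw [map_add, map_add, map_smul, map_smul, map_smul, map_smul, hf, ht]

end QuantumWalk

theorem mainTheorem2 (M : ℕ) [NeZero M] (C : Matrix.unitaryGroup (Fin 2) ℂ)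
    (ha : C.1 0 0 ≠ 0) :
    -- the matrix inverse `G_M(ξ)` exists for every `ξ`
    (∀ ξ : Torus, IsUnit (impurityDenominator M C ξ)) ∧
    -- the wave operators exist
    ∃ Wp Wm : StateSpace →L[ℂ] StateSpace,
      IsWaveOperator (impurityWalk M C) freeWalk atTop Wp ∧
      IsWaveOperator (impurityWalk M C) freeWalk atBot Wm ∧
      -- the scattering operator in momentum space
      (∀ f : MomentumSpace, ∀ᵐ ξ : Torus,
        momentumConj (scatteringOperator Wp Wm) f ξ =
          act (transmissionMatrix M C ξ) (f ξ) + act (reflectionMatrix M C ξ) (f (-ξ))) ∧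
      -- the scattering matrix: the explicit family is the one that decomposes the operator
      ∃ S : (θ : ℝ) → Fibre θ →ₗ[ℂ] Fibre θ,
        (∀ (θ : ℝ) (ψ : Fibre θ) (s : Bool),
          S θ ψ (branch θ s) =
            act (transmissionMatrix M C (branch θ s).1) (ψ (branch θ s)) +
            act (reflectionMatrix M C (branch θ s).1) (ψ (negPoint (branch θ s)))) ∧
        IsFibreFamily (momentumConj (scatteringOperator Wp Wm)) S ∧
        ∀ S' : (θ : ℝ) → Fibre θ →ₗ[ℂ] Fibre θ,
          IsFibreFamily (momentumConj (scatteringOperator Wp Wm)) S' →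
          ∀ᵐ θ ∂(volume.restrict (Set.Icc (0 : ℝ) (2 * Real.pi))), S' θ = S θ := by
  refine ⟨fun ξ => isUnit_one_sub_smul_impurityBlock_sq ha (norm_fourier_apply (-1) ξ), ?_⟩
  obtain ⟨Wp, hp⟩ := exists_isWaveOperator_atTop M C
  obtain ⟨Wm, hm⟩ := exists_isWaveOperator_atBot M C
  have hS := momentumConj_scatteringOperator_apply ha hp hm
  have hfib := isFibreFamily_fibreOperator hS
  exact ⟨Wp, Wm, hp, hm, hS, fibreOperator (transmissionMatrix M C) (reflectionMatrix M C),
    fun θ ψ s => fibreOperator_apply _ _ θ ψ (branch θ s), hfib,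
    fun S' hS' => hfib.ae_eq hS'⟩
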